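/- Let $R_1,R_2>0$ with $R_1\neq R_2$, and let $M=\mathbb S^2\times\mathbb S^2$, where each factor is the unit sphere in $\mathbb R^3$ with Cartesian coordinates $(x_i,y_i,z_i)$, $i=1,2$. Equip $M$ with the symplectic form $\omega=-(R_1\,\omega_{\mathbb S^2}\oplus R_2\,\omega_{\mathbb S^2})$, where $\omega_{\mathbb S^2}$ is the standard area form. For $(s_1,s_2)\in[0,1]^2$ let $F=(L,H):M\to\mathbb R^2$, $$L=R_1z_1+R_2z_2,\qquad H=(1-2s_1)(1-s_2)z_1+(1-2s_1)s_2z_2+2(s_1+s_2-s_1^2-s_2^2)(x_1x_2+y_1y_2),$$ and let $$E=R_2^2(1-2s_1)^2(s_2-1)^2+R_1^2(1-2s_1)^2s_2^2-2R_1R_2\bigl(8(s_1-1)^2s_1^2+s_2-12(s_1-1)s_1s_2+(7+12(s_1-1)s_1)s_2^2-16s_2^3+8s_2^4\bigr).$$ Call $(M,\omega,(L,H))$ semitoric if it is a completely integrable system on a connected symplectic $4$-manifold ($L,H$ smooth and Poisson-commuting, $dL,dH$ linearly independent almost everywhere), all its singularities (points where $dL,dH$ are linearly dependent) are non-degenerate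 without hyperbolic components, the Hamiltonian flow of $L$ is $2\pi$-periodic and defines an effective circle action, and $L$ is proper; call it simple if moreover each level set of $L$ contains at most one focus-focus singularity. Write $N=(0,0,1)$, $S=(0,0,-1)$. Then: 1. If $(s_1,s_2)\in[0,1]^2$ and $E\neq0$, the system is (simple) semitoric. 2. If $(s_1,s_2)\in[0,1]^2$ and $E=0$, the system is not semitoric, and the points $N\times S$ and $S\times N$ are degenerate singularities. 3. For $(s_1,s_2)\in[0,1]^2$, the number of focus-focus points is $2$ if $E<0$ and $0$ if $E>0$. 4. The set $\{(s_1,s_2)\in[0,1]^2: E=0\}$ is a piecewise smooth curve (a non-empty finite union of regular smooth simple arcs), and the system is (simple) semitoric for almost every $(s_1,s_2)\in[0,1]^2$. -/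

import Mathlib

open Set MeasureTheory Polynomial
open scoped Manifold ContDiff

noncomputable section

attribute [local instance 100] LieRing.ofAssociativeRing

/-! ### Symplectic manifolds and Hamiltonian vector fields -/

section General

/-- The pullback `(u, v) ↦ B (D u) (D v)` of a bilinear form along a linear map. -/
def pullbackBilin {V W : Type*} [AddCommGroup V] [Module ℝ V] [TopologicalSpace V]
    [AddCommGroup W] [Module ℝ W] [TopologicalSpace W]
    (D : V →L[ℝ] W) (B : W →L[ℝ] W →L[ℝ] ℝ) : V →L[ℝ] V →L[ℝ] ℝ :=
  (D.precomp ℝ).comp (B.comp D)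

theorem pullbackBilin_apply {V W : Type*} [AddCommGroup V] [Module ℝ V] [TopologicalSpace V]
    [AddCommGroup W] [Module ℝ W] [TopologicalSpace W]
    (D : V →L[ℝ] W) (B : W →L[ℝ] W →L[ℝ] ℝ) (u v : V) :
    pullbackBilin D B u v = B (D u) (D v) := rfl

variable {E : Type*} [NormedAddCommGroup E] [NormedSpace ℝ E]
  {H : Type*} [TopologicalSpace H] (I : ModelWithCorners ℝ E H)
  {M : Type*} [TopologicalSpace M] [ChartedSpace H M]

variable (M) in
/-- A field of bilinear forms on the tangent spaces of `M`. -/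
abbrev BilinField : Type _ :=
  ∀ p : M, TangentSpace I p →L[ℝ] TangentSpace I p →L[ℝ] ℝ

variable {I}

/-- The coordinate expression, in the preferred chart around `p₀`, of a field of bilinear forms:
its pullback along the inverse of the chart. It is meaningful on the target of the chart. -/
def coordForm (Ω : BilinField I M) (p₀ : M) (x : E) : E →L[ℝ] E →L[ℝ] ℝ :=
  pullbackBilin (V := E) (mfderiv 𝓘(ℝ, E) I (extChartAt I p₀).symm x)
    (Ω ((extChartAt I p₀).symm x))

/-- `Ω` is a symplectic form on `M` (a manifold without boundary): a smooth, closed,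
non-degenerate `2`-form. Smoothness and closedness are expressed in the charts, the latter by the
vanishing of `(dΩ)(u, v, w) = ∂ᵤ Ω(v, w) + ∂ᵥ Ω(w, u) + ∂_w Ω(u, v)` on constant fields. -/
structure IsSymplecticForm (Ω : BilinField I M) : Prop where
  alternating : ∀ p v, Ω p v v = 0
  nondegenerate : ∀ p v, (∀ w, Ω p v w = 0) → v = 0
  smooth : ∀ p₀, ContDiffOn ℝ ∞ (coordForm Ω p₀) (extChartAt I p₀).target
  closed : ∀ p₀, ∀ x ∈ (extChartAt I p₀).target, ∀ u v w : E,
    fderiv ℝ (coordForm Ω p₀) x u v w + fderiv ℝ (coordForm Ω p₀) x v w u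
      + fderiv ℝ (coordForm Ω p₀) x w u v = 0

/-- The Hamiltonian vector field `X_f` of `f`, that is, `Ω(X_f, ·) = -df`. -/
def hamVF (Ω : BilinField I M) (f : M → ℝ) (p : M) : TangentSpace I p :=
  -(ContinuousLinearMap.inverse (Ω p) (mvfderiv I f p))

/-- The Poisson bracket `{f, g} = Ω(X_f, X_g)`. -/
def poissonBracket (Ω : BilinField I M) (f g : M → ℝ) (p : M) : ℝ :=
  Ω p (hamVF Ω f p) (hamVF Ω g p)

variable (I)

/-- The second derivative of `f` at `p`, computed in the preferred chart at `p` (which is the chart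
identifying `TangentSpace I p` with `E`). When `df(p) = 0`, this is the Hessian `D²f(p)`. -/
def hessianAt (f : M → ℝ) (p : M) : TangentSpace I p →L[ℝ] TangentSpace I p →L[ℝ] ℝ :=
  (fderiv ℝ (fderiv ℝ (f ∘ (extChartAt I p).symm)) (extChartAt I p p) : E →L[ℝ] E →L[ℝ] ℝ)

variable {I}

/-- The linearization `A_f` at a critical point `p` of `f` of the Hamiltonian vector field of `f`:
the endomorphism of the tangent space at `p` such that `Ω(A_f v, w) = -D²f(p)(v, w)`. -/
def linHam (Ω : BilinField I M) (f : M → ℝ) (p : M) :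
    TangentSpace I p →L[ℝ] TangentSpace I p :=
  -((ContinuousLinearMap.inverse (Ω p)).comp (hessianAt I f p))

/-! ### Singularities of a pair of functions on a symplectic 4-manifold -/

variable (I)

/-- The rank at `p` of the differential of `(L, K) : M → ℝ²`. -/
def rankAt (L K : M → ℝ) (p : M) : ℕ :=
  Module.finrank ℝ (Submodule.span ℝ {mvfderiv I L p, mvfderiv I K p})

/-- `p` is a singularity of `(L, K)`: the differentials are linearly dependent at `p`. -/
def IsSingularPt (L K : M → ℝ) (p : M) : Prop := rankAt I L K p < 2

variable {I}

/-- The Lie algebra `sp(T_p M, Ω_p)` of the infinitesimally symplectic endomorphisms. -/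
abbrev spAt (Ω : BilinField I M) (p : M) : LieSubalgebra ℝ (Module.End ℝ (TangentSpace I p)) :=
  skewAdjointLieSubalgebra (Ω p).toBilinForm

/-- The Lie subalgebra of `sp(T_p M, Ω_p)` generated by the linearizations `A_L` and `A_K`. -/
def linAlgebra (Ω : BilinField I M) (L K : M → ℝ) (p : M) : LieSubalgebra ℝ (spAt Ω p) :=
  LieSubalgebra.lieSpan ℝ (spAt Ω p)
    {A | (A : Module.End ℝ (TangentSpace I p)) = (linHam Ω L p).toLinearMap ∨
      (A : Module.End ℝ (TangentSpace I p)) = (linHam Ω K p).toLinearMap}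

/-- A non-degenerate singularity of rank `0`: the linearizations of the Hamiltonian vector fields
generate a Cartan subalgebra of `sp(T_p M, Ω_p)`. -/
def IsNondegRankZero (Ω : BilinField I M) (L K : M → ℝ) (p : M) : Prop :=
  rankAt I L K p = 0 ∧ (linAlgebra Ω L K p).IsCartanSubalgebra

/-- The line `ℓ` spanned by the Hamiltonian vector fields at a singularity of rank `1`. -/
def orbitSpace (Ω : BilinField I M) (L K : M → ℝ) (p : M) : Submodule ℝ (TangentSpace I p) :=
  Submodule.span ℝ {hamVF Ω L p, hamVF Ω K p}

/-- The symplectic orthogonal `ℓ'` of `ℓ`. -/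
def orbitOrth (Ω : BilinField I M) (L K : M → ℝ) (p : M) : Submodule ℝ (TangentSpace I p) :=
  (Ω p).toBilinForm.orthogonal (orbitSpace Ω L K p)

variable (I) in
/-- `(a, b) ≠ 0` and `a dL + b dK = 0` at `p`. -/
def IsCriticalCombination (L K : M → ℝ) (p : M) (a b : ℝ) : Prop :=
  (a ≠ 0 ∨ b ≠ 0) ∧ a • mvfderiv I L p + b • mvfderiv I K p = 0

/-- A non-degenerate singularity of rank `1`: if `(a, b) ≠ 0` and `a dL + b dK = 0` at `p`, then
the Hessian of `a L + b K` induces a non-degenerate form on `ℓ' / ℓ`. -/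
def IsNondegRankOne (Ω : BilinField I M) (L K : M → ℝ) (p : M) : Prop :=
  rankAt I L K p = 1 ∧ ∃ a b : ℝ, IsCriticalCombination I L K p a b ∧
    ∀ v ∈ orbitOrth Ω L K p,
      (∀ w ∈ orbitOrth Ω L K p, hessianAt I (fun q => a * L q + b * K q) p v w = 0) →
      v ∈ orbitSpace Ω L K p

/-- A non-degenerate singularity. -/
def IsNondegSingularPt (Ω : BilinField I M) (L K : M → ℝ) (p : M) : Prop :=
  IsNondegRankZero Ω L K p ∨ IsNondegRankOne Ω L K p

/-- A degenerate singularity. -/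
def IsDegenerateSingularPt (Ω : BilinField I M) (L K : M → ℝ) (p : M) : Prop :=
  IsSingularPt I L K p ∧ ¬ IsNondegSingularPt Ω L K p

section Types

variable [FiniteDimensional ℝ E]

/-- The characteristic polynomial of the linearization of `X_{aL + bK}`. -/
def linCharpoly (Ω : BilinField I M) (L K : M → ℝ) (p : M) (a b : ℝ) : ℝ[X] :=
  have : FiniteDimensional ℝ (TangentSpace I p) := inferInstanceAs (FiniteDimensional ℝ E)
  (linHam Ω (fun q => a * L q + b * K q) p).toLinearMap.charpoly

/-- A singularity of focus-focus type (on a 4-manifold): non-degenerate of rank `0`, and some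
element `A_{aL + bK}` of the Cartan subalgebra has four distinct eigenvalues `±α ± iβ` with
`α, β ≠ 0`. -/
def IsFocusFocus (Ω : BilinField I M) (L K : M → ℝ) (p : M) : Prop :=
  IsNondegRankZero Ω L K p ∧ ∃ a b α β : ℝ, α ≠ 0 ∧ β ≠ 0 ∧
    linCharpoly Ω L K p a b =
      (X ^ 2 - C (2 * α) * X + C (α ^ 2 + β ^ 2)) * (X ^ 2 + C (2 * α) * X + C (α ^ 2 + β ^ 2))

/-- A singularity of elliptic-elliptic type (on a 4-manifold): non-degenerate of rank `0`, and some
element `A_{aL + bK}` of the Cartan subalgebra has four distinct eigenvalues `±iα, ±iβ`. -/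
def IsEllipticElliptic (Ω : BilinField I M) (L K : M → ℝ) (p : M) : Prop :=
  IsNondegRankZero Ω L K p ∧ ∃ a b α β : ℝ, 0 < α ∧ α < β ∧
    linCharpoly Ω L K p a b = (X ^ 2 + C (α ^ 2)) * (X ^ 2 + C (β ^ 2))

end Types

/-- A singularity of elliptic-regular type (on a 4-manifold): non-degenerate of rank `1`, and the
form induced on the plane `ℓ' / ℓ` by the Hessian of a critical combination is definite (positive
definite, after changing the sign of `(a, b)`). -/
def IsEllipticRegular (Ω : BilinField I M) (L K : M → ℝ) (p : M) : Prop :=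
  IsNondegRankOne Ω L K p ∧ ∃ a b : ℝ, IsCriticalCombination I L K p a b ∧
    ∀ v ∈ orbitOrth Ω L K p, v ∉ orbitSpace Ω L K p →
      0 < hessianAt I (fun q => a * L q + b * K q) p v v

/-! ### Semitoric systems -/

variable (I) in
/-- A subset of a manifold has measure zero: it is a null set in every preferred chart. -/
def IsNullInCharts [MeasurableSpace E] [BorelSpace E] (S : Set M) : Prop :=
  ∀ (μ : Measure E) [μ.IsAddHaarMeasure] (p : M),
    μ ((extChartAt I p).target ∩ (extChartAt I p).symm ⁻¹' S) = 0

/-- `(M, Ω, (L, K))` is a completely integrable system with two degrees of freedom. -/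
structure IsCompletelyIntegrable [MeasurableSpace E] [BorelSpace E]
    (Ω : BilinField I M) (L K : M → ℝ) : Prop where
  connected : ConnectedSpace M
  dim_eq : Module.finrank ℝ E = 4
  symplectic : IsSymplecticForm Ω
  smooth_fst : ContMDiff I 𝓘(ℝ, ℝ) ∞ L
  smooth_snd : ContMDiff I 𝓘(ℝ, ℝ) ∞ K
  rank_ae : IsNullInCharts I {p : M | IsSingularPt I L K p}
  commute : ∀ p, poissonBracket Ω L K p = 0

/-- The flow of the Hamiltonian vector field of `L` is `2π`-periodic and defines an effective
action of the circle `ℝ / 2πℤ` on `M`. -/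
def InducesEffectiveCircleAction (Ω : BilinField I M) (L : M → ℝ) : Prop :=
  ∃ Φ : ℝ → M → M,
    (∀ p, Φ 0 p = p ∧ IsMIntegralCurve (I := I) (fun t => Φ t p) (hamVF Ω L)) ∧
    (∀ t p, Φ (t + 2 * Real.pi) p = Φ t p) ∧
    (∀ t, (∀ p, Φ t p = p) → ∃ n : ℤ, t = n * (2 * Real.pi))

/-- `(M, Ω, (L, K))` is a semitoric system. In dimension four, the non-degenerate singularities
without hyperbolic components are those of elliptic-elliptic, focus-focus and elliptic-regular
type. -/
structure IsSemitoric [MeasurableSpace E] [BorelSpace E] [FiniteDimensional ℝ E]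
    (Ω : BilinField I M) (L K : M → ℝ) : Prop where
  integrable : IsCompletelyIntegrable Ω L K
  singularities : ∀ p, IsSingularPt I L K p →
    IsEllipticElliptic Ω L K p ∨ IsFocusFocus Ω L K p ∨ IsEllipticRegular Ω L K p
  circle_action : InducesEffectiveCircleAction Ω L
  proper : ∀ S : Set ℝ, IsCompact S → IsCompact (L ⁻¹' S)

/-- A semitoric system is simple if each level set of `L` has at most one focus-focus point. -/
structure IsSimpleSemitoric [MeasurableSpace E] [BorelSpace E] [FiniteDimensional ℝ E]
    (Ω : BilinField I M) (L K : M → ℝ) : Prop extends IsSemitoric Ω L K where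
  simple : ∀ p q, IsFocusFocus Ω L K p → IsFocusFocus Ω L K q → L p = L q → p = q

end General

/-! ### The family of systems on the product of two spheres -/

/-- `ℝ³`. -/
abbrev R3 : Type := EuclideanSpace ℝ (Fin 3)

/-- The unit sphere of `ℝ³`. -/
abbrev S2 : Type := Metric.sphere (0 : R3) 1

instance : Fact (Module.finrank ℝ R3 = 2 + 1) := ⟨finrank_euclideanSpace_fin⟩

/-- The bilinear form `(u, v) ↦ x · (u × v) = det (x, u, v)` on `ℝ³`. -/
def detForm (x : R3) : R3 →L[ℝ] R3 →L[ℝ] ℝ :=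
  let e : Fin 3 → (R3 →L[ℝ] ℝ) := fun i => EuclideanSpace.proj i
  x 0 • ((e 1).smulRight (e 2) - (e 2).smulRight (e 1))
    + x 1 • ((e 2).smulRight (e 0) - (e 0).smulRight (e 2))
    + x 2 • ((e 0).smulRight (e 1) - (e 1).smulRight (e 0))

theorem detForm_apply (x u v : R3) :
    detForm x u v = Matrix.det !![x 0, x 1, x 2; u 0, u 1, u 2; v 0, v 1, v 2] := by
  simp [detForm, Matrix.det_fin_three]
  ring

/-- The standard symplectic (area) form of the unit sphere, `(u, v) ↦ det (p, u, v)`. -/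
def areaForm : BilinField (𝓡 2) S2 := fun p =>
  pullbackBilin (mvfderiv (𝓡 2) (fun q : S2 => (q : R3)) p) (detForm (p : R3))

/-- The symplectic form `-(R₁ σ ⊕ R₂ σ)` on `S² × S²`, where `σ` is `areaForm`. -/
def prodForm (R₁ R₂ : ℝ) : BilinField ((𝓡 2).prod (𝓡 2)) (S2 × S2) := fun p =>
  -(R₁ • pullbackBilin (mfderiv ((𝓡 2).prod (𝓡 2)) (𝓡 2) Prod.fst p) (areaForm p.1)
    + R₂ • pullbackBilin (mfderiv ((𝓡 2).prod (𝓡 2)) (𝓡 2) Prod.snd p) (areaForm p.2))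

/-- `L = R₁ z₁ + R₂ z₂`. -/
def sysL (R₁ R₂ : ℝ) (p : S2 × S2) : ℝ :=
  R₁ * (p.1 : R3) 2 + R₂ * (p.2 : R3) 2

/-- `H = (1-2s₁)(1-s₂) z₁ + (1-2s₁) s₂ z₂ + 2(s₁+s₂-s₁²-s₂²)(x₁x₂ + y₁y₂)`. -/
def sysH (s₁ s₂ : ℝ) (p : S2 × S2) : ℝ :=
  (1 - 2 * s₁) * (1 - s₂) * (p.1 : R3) 2 + (1 - 2 * s₁) * s₂ * (p.2 : R3) 2
    + 2 * (s₁ + s₂ - s₁ ^ 2 - s₂ ^ 2)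
      * ((p.1 : R3) 0 * (p.2 : R3) 0 + (p.1 : R3) 1 * (p.2 : R3) 1)

/-- The north pole `(0, 0, 1)`. -/
def northPole : S2 := ⟨!₂[0, 0, 1], by simp [EuclideanSpace.norm_eq, Fin.sum_univ_three]⟩

/-- The south pole `(0, 0, -1)`. -/
def southPole : S2 := ⟨!₂[0, 0, -1], by simp [EuclideanSpace.norm_eq, Fin.sum_univ_three]⟩

/-- The polynomial `E`. -/
def polyE (R₁ R₂ s₁ s₂ : ℝ) : ℝ :=
  R₂ ^ 2 * (1 - 2 * s₁) ^ 2 * (-1 + s₂) ^ 2 + R₁ ^ 2 * (1 - 2 * s₁) ^ 2 * s₂ ^ 2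
    - 2 * R₁ * R₂ * (8 * (-1 + s₁) ^ 2 * s₁ ^ 2 + s₂ - 12 * (-1 + s₁) * s₁ * s₂
      + (7 + 12 * (-1 + s₁) * s₁) * s₂ ^ 2 - 16 * s₂ ^ 3 + 8 * s₂ ^ 4)

/-- A piecewise smooth curve in the plane, possibly with several components: a non-empty finite
union of regular smooth simple arcs. -/
def IsPiecewiseSmoothCurve (Z : Set (ℝ × ℝ)) : Prop :=
  ∃ (n : ℕ) (γ : Fin n → ℝ → ℝ × ℝ), 0 < n ∧
    (∀ i, ContDiffOn ℝ ∞ (γ i) (Icc 0 1) ∧ InjOn (γ i) (Icc 0 1) ∧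
      ∀ t ∈ Icc (0 : ℝ) 1, derivWithin (γ i) (Icc 0 1) t ≠ 0) ∧
    Z = ⋃ i, γ i '' Icc 0 1

end

/-! Every function involved is a restriction to the spheres of `A z₁ + B z₂ + C (x₁ x₂ + y₁ y₂)`
(`sphereFun`). It is invariant under the simultaneous rotation about the vertical axes, which is the
flow of `L`; this gives the commutation of `L` and `H` and the circle action. The standing
hypothesis `C = 0 → A R₂ ≠ B R₁` says that `H` is not a multiple of `L`. It holds on the whole
parameter square, since `C` vanishes only at the corners (`coupling_ne_zero_or`).

Away from the four products of poles, `dL ≠ 0` and singularities have rank one. The Lagrange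
multipliers `l`, `m` of a critical combination with coupling `C ≠ 0` satisfy `l m = C²`. Hence `-l`
times its Hessian is a sum of squares which, on `ker dL`, vanishes only along the orbit of the
circle. When the coupling vanishes, one point is a pole and definiteness is direct. So these points
are always elliptic-regular (`exists_definite_of_critical`, `isEllipticRegular_of_singular`).

At a product of poles both differentials vanish. Identifying the tangent space with `ℂ²`, the
linearizations are `i · 1` for `L` and `i M` for `H`, with `M` a real `2 × 2` matrix; `poleDisc` is
the discriminant of its characteristic polynomial. If it is non-zero, the trace form is
non-degenerate on the span of the two linearizations, which forces normalizer, centralizer and span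
to coincide: a Cartan subalgebra (`isNondegRankZero_of_poleDisc`). If it is zero and `C ≠ 0`, the
traceless part of `M` is a non-zero nilpotent, and an explicit symplectic element scales it, so the
span is not self-normalizing (`not_isNondegRankZero_of_poleDisc`). The eigenvalues `± i λ`, with `λ`
an eigenvalue of a combination of `1` and `M`, make a positive discriminant elliptic-elliptic and a
negative one focus-focus.

At equal poles the discriminant is a sum of non-negative terms and is positive. At opposite poles it
is a positive multiple of `mixedDisc`, and `E` is exactly this quantity (`polyE_eq_mixedDisc`). The
sign of `E` therefore decides everything. The assumption `R₁ ≠ R₂` only separates the values of `L`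
at the two focus-focus points.

For the zero set, put `x = 1 - 2 s₁` and `y = 1 - 2 s₂`. Then `E` is a difference of squares whose
two factors are quadratic in `x`, exchanged by `x ↦ -x`, each with one root of either sign. This
exhibits the curve as four graphs over intervals of `y` (`polyE_eq_zero_iff`,
`isPiecewiseSmoothCurve_posRoot`). It is null because each slice in `s₂` is the root set of a
genuine quartic. -/

noncomputable section

attribute [local instance 100] LieRing.ofAssociativeRing

/-! ### The charts of the sphere -/

/-- The model space of the sphere. -/
abbrev E2 : Type := EuclideanSpace ℝ (Fin 2)

/-- The isometry of the model plane onto the plane tangent to the sphere at `p` given by the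
preferred chart at `p`. -/
def frame (p : S2) : E2 →ₗᵢ[ℝ] R3 :=
  (ℝ ∙ (((-p : S2)) : R3))ᗮ.subtypeₗᵢ.comp
    (OrthonormalBasis.fromOrthogonalSpanSingleton 2
      (ne_zero_of_mem_unit_sphere (-p))).repr.symm.toLinearIsometry

/-- The inverse of the preferred chart at `p`, as a map to `ℝ³`. -/
def invChart (p : S2) (w : E2) : R3 :=
  (‖w‖ ^ 2 + 4)⁻¹ • ((4 : ℝ) • frame p w + (4 - ‖w‖ ^ 2) • (p : R3))

/-- The preferred chart at `p` is the stereographic projection from `-p`, so it is centred at `p`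
and the inverse chart is defined on the whole plane. -/
theorem extChartAt_sphere (p : S2) :
    extChartAt (𝓡 2) p = (stereographic' 2 (-p)).toPartialEquiv := by
  simp [mfld_simps, extChartAt]
  rfl

theorem extChartAt_sphere_target (p : S2) : (extChartAt (𝓡 2) p).target = univ := by
  rw [extChartAt_sphere]
  exact stereographic'_target (-p)

theorem coe_extChartAt_symm (p : S2) (w : E2) :
    (((extChartAt (𝓡 2) p).symm w : S2) : R3) = invChart p w := by
  rw [extChartAt_sphere]
  have h := stereographic'_symm_apply (n := 2) (-p) w
  have h2 : ‖frame p w‖ = ‖w‖ := (frame p).norm_map w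
  refine h.trans ?_
  change (‖frame p w‖ ^ 2 + 4)⁻¹ • (4 : ℝ) • (frame p w) +
        (‖frame p w‖ ^ 2 + 4)⁻¹ • (‖frame p w‖ ^ 2 - 4) • (-(p : R3)) = _
  rw [h2, invChart]
  module

theorem extChartAt_sphere_self (p : S2) : extChartAt (𝓡 2) p p = (0 : E2) := by
  have h : (extChartAt (𝓡 2) p).symm (0 : E2) = p := by
    apply Subtype.ext
    rw [coe_extChartAt_symm]
    simp [invChart]
  have := (extChartAt (𝓡 2) p).right_inv (x := 0) (by rw [extChartAt_sphere_target]; trivial)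
  rwa [h] at this

theorem inner_frame_frame (p : S2) (u v : E2) : inner ℝ (frame p u) (frame p v) = inner ℝ u v :=
  (frame p).inner_map_map u v

theorem inner_frame_self (p : S2) (u : E2) : inner ℝ (p : R3) (frame p u) = 0 := by
  have h : frame p u ∈ (ℝ ∙ (((-p : S2)) : R3))ᗮ :=
    ((OrthonormalBasis.fromOrthogonalSpanSingleton 2
      (ne_zero_of_mem_unit_sphere (-p))).repr.symm u).2
  rw [Submodule.mem_orthogonal_singleton_iff_inner_right] at h
  simpa using h

theorem exists_frame_eq (p : S2) (x : R3) (hx : inner ℝ (p : R3) x = 0) :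
    ∃ u, frame p u = x := by
  have h : x ∈ (ℝ ∙ (((-p : S2)) : R3))ᗮ := by
    rw [Submodule.mem_orthogonal_singleton_iff_inner_right]
    simpa using hx
  refine ⟨(OrthonormalBasis.fromOrthogonalSpanSingleton 2
      (ne_zero_of_mem_unit_sphere (-p))).repr ⟨x, h⟩, ?_⟩
  exact congrArg Subtype.val (LinearIsometryEquiv.symm_apply_apply
    (OrthonormalBasis.fromOrthogonalSpanSingleton 2
      (ne_zero_of_mem_unit_sphere (-p))).repr ⟨x, h⟩)

theorem contDiff_invChart (p : S2) : ContDiff ℝ ω (invChart p) := by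
  unfold invChart
  have h₀ : ContDiff ℝ ω fun w : E2 => ‖w‖ ^ 2 := contDiff_norm_sq ℝ
  refine ((h₀.add contDiff_const).inv ?_).smul (((frame p).contDiff.const_smul _).add
    ((contDiff_const.sub h₀).smul contDiff_const))
  intro x
  positivity

theorem hasFDerivAt_invChart (p : S2) (w : E2) :
    HasFDerivAt (invChart p)
      ((‖w‖ ^ 2 + 4)⁻¹ • ((4 : ℝ) • (frame p).toContinuousLinearMap
        - (2 : ℝ) • (innerSL ℝ w).smulRight (p : R3))
      - (2 * ((‖w‖ ^ 2 + 4)⁻¹) ^ 2) • (innerSL ℝ w).smulRight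
        ((4 : ℝ) • frame p w + (4 - ‖w‖ ^ 2) • (p : R3))) w := by
  have h₀ : HasFDerivAt (fun w : E2 => ‖w‖ ^ 2) ((2 : ℝ) • innerSL ℝ w) w := by
    simpa [two_smul] using (hasStrictFDerivAt_norm_sq w).hasFDerivAt
  have hw : ‖w‖ ^ 2 + 4 ≠ 0 := by positivity
  have h₁ := (hasDerivAt_inv hw).comp_hasFDerivAt w (h₀.add_const 4)
  have h₂ := (((frame p).toContinuousLinearMap.hasFDerivAt (x := w)).const_smul (4 : ℝ)).add
    ((h₀.const_sub 4).smul_const (p : R3))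
  have h₃ := h₁.smul h₂
  refine h₃.congr_fderiv ?_
  ext1 v
  simp
  module

theorem fderiv_invChart_zero (p : S2) :
    fderiv ℝ (invChart p) 0 = (frame p).toContinuousLinearMap := by
  rw [(hasFDerivAt_invChart p 0).fderiv]
  ext1 v
  simp only [norm_zero, map_zero, sub_apply, smul_apply,
    ContinuousLinearMap.smulRight_apply, zero_apply,
    LinearIsometry.coe_toContinuousLinearMap]
  module

/-- This is the second fundamental form of the unit sphere: stereographic coordinates have no
tangential second-order term at their centre. -/
theorem fderiv_fderiv_invChart_zero (p : S2) (u v : E2) :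
    fderiv ℝ (fderiv ℝ (invChart p)) 0 u v = -(inner ℝ u v : ℝ) • (p : R3) := by
  have hd : DifferentiableAt ℝ (fderiv ℝ (invChart p)) 0 :=
    (((contDiff_invChart p).fderiv_right (m := 1) (by simp)).differentiable (by simp)) 0
  have h1 : fderiv ℝ (fderiv ℝ (invChart p)) 0 u v
      = fderiv ℝ (fun w => fderiv ℝ (invChart p) w v) 0 u := by
    rw [fderiv_clm_apply hd (differentiableAt_const v)]
    simp
  have h2 : (fun w => fderiv ℝ (invChart p) w v) = fun w => 
      ((‖w‖ ^ 2 + 4)⁻¹ • ((4 : ℝ) • frame p v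
        - (2 * inner ℝ w v : ℝ) • (p : R3))
      - (2 * ((‖w‖ ^ 2 + 4)⁻¹) ^ 2 * inner ℝ w v : ℝ) • 
        ((4 : ℝ) • frame p w + (4 - ‖w‖ ^ 2) • (p : R3))) := by
    funext w
    rw [(hasFDerivAt_invChart p w).fderiv]
    simp
    module
  rw [h1, h2]
  have h₀ : HasFDerivAt (fun w : E2 => ‖w‖ ^ 2) ((2 : ℝ) • innerSL ℝ (0 : E2)) 0 := by
    simpa [two_smul] using (hasStrictFDerivAt_norm_sq (0 : E2)).hasFDerivAt
  have hw : ‖(0 : E2)‖ ^ 2 + 4 ≠ 0 := by positivity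
  have h₁ := (hasDerivAt_inv hw).comp_hasFDerivAt 0 (h₀.add_const 4)
  have h₂ := (((frame p).toContinuousLinearMap.hasFDerivAt (x := 0)).const_smul (4 : ℝ)).add
    ((h₀.const_sub 4).smul_const (p : R3))
  have h₄ : HasFDerivAt (fun w : E2 => (inner ℝ w v : ℝ)) (innerSL ℝ v) 0 := by
    have := (innerSL ℝ v).hasFDerivAt (x := (0 : E2))
    refine this.congr_of_eventuallyEq (Filter.Eventually.of_forall fun w => ?_)
    simp [real_inner_comm]
  have h := (h₁.smul ((hasFDerivAt_const ((4 : ℝ) • frame p v) (0 : E2)).sub 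
     ((h₄.const_mul 2).smul_const (p : R3)))).sub ((((h₁.pow 2).const_mul 2).mul h₄).smul h₂)
  have h' := h.fderiv
  refine (congrArg (fun φ => φ u) h').trans ?_
  simp [real_inner_comm]
  module

/-! ### First and second derivatives of the functions of the family -/

/-- The model space of the product of two spheres. -/
abbrev E22 : Type := E2 × E2

/-- The model with corners of the product of two spheres. -/
abbrev I22 : ModelWithCorners ℝ E22 (ModelProd E2 E2) := (𝓡 2).prod (𝓡 2)

/-- The function `A x₃ + B y₃ + C (x₁ y₁ + x₂ y₂)` on `ℝ³ × ℝ³`. -/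
def quadFun (A B C : ℝ) (x y : R3) : ℝ := A * x 2 + B * y 2 + C * (x 0 * y 0 + x 1 * y 1)

/-- The restriction of `quadFun` to the product of two spheres. -/
def sphereFun (A B C : ℝ) (p : S2 × S2) : ℝ := quadFun A B C p.1 p.2

theorem sysL_eq (R₁ R₂ : ℝ) : sysL R₁ R₂ = sphereFun R₁ R₂ 0 := by
  funext p
  simp [sysL, sphereFun, quadFun]

theorem sysH_eq (s₁ s₂ : ℝ) : sysH s₁ s₂ = sphereFun ((1 - 2 * s₁) * (1 - s₂))
    ((1 - 2 * s₁) * s₂) (2 * (s₁ + s₂ - s₁ ^ 2 - s₂ ^ 2)) := by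
  funext p
  simp [sysH, sphereFun, quadFun]

theorem sphereFun_combination (a b A B C A' B' C' : ℝ) :
    (fun q => a * sphereFun A B C q + b * sphereFun A' B' C' q)
      = sphereFun (a * A + b * A') (a * B + b * B') (a * C + b * C') := by
  funext p
  simp only [sphereFun, quadFun]
  ring

theorem hasFDerivAt_quadFun {V : Type*} [NormedAddCommGroup V] [NormedSpace ℝ V] (A B C : ℝ)
    {f g : V → R3} {f' g' : V →L[ℝ] R3} {w : V} (hf : HasFDerivAt f f' w)
    (hg : HasFDerivAt g g' w) :
    ∃ D : V →L[ℝ] ℝ, HasFDerivAt (fun w => quadFun A B C (f w) (g w)) D w ∧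
      ∀ v, D v = quadFun A 0 C (f' v) (g w) + quadFun 0 B C (f w) (g' v) := by
  have hp (i : Fin 3) (h : V → R3) (h' : V →L[ℝ] R3) (hh : HasFDerivAt h h' w) :
      HasFDerivAt (fun w => h w i) ((EuclideanSpace.proj i : R3 →L[ℝ] ℝ).comp h') w :=
    (EuclideanSpace.proj i : R3 →L[ℝ] ℝ).hasFDerivAt.comp w hh
  refine ⟨_, (((hp 2 f f' hf).const_mul A).add ((hp 2 g g' hg).const_mul B)).add
    ((((hp 0 f f' hf).mul (hp 0 g g' hg)).add ((hp 1 f f' hf).mul (hp 1 g g' hg))).const_mul C),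
    fun v => ?_⟩
  simp [quadFun]
  ring

theorem fderiv_quadFun {V : Type*} [NormedAddCommGroup V] [NormedSpace ℝ V] (A B C : ℝ)
    {f g : V → R3} {f' g' : V →L[ℝ] R3} {w : V} (hf : HasFDerivAt f f' w)
    (hg : HasFDerivAt g g' w) (v : V) :
    fderiv ℝ (fun w => quadFun A B C (f w) (g w)) w v
      = quadFun A 0 C (f' v) (g w) + quadFun 0 B C (f w) (g' v) := by
  obtain ⟨D, h1, h2⟩ := hasFDerivAt_quadFun A B C hf hg
  rw [h1.fderiv, h2]

theorem contDiff_quadFun {V : Type*} [NormedAddCommGroup V] [NormedSpace ℝ V] (A B C : ℝ)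
    {n : WithTop ℕ∞} {f g : V → R3} (hf : ContDiff ℝ n f) (hg : ContDiff ℝ n g) :
    ContDiff ℝ n (fun w => quadFun A B C (f w) (g w)) := by
  have hp (i : Fin 3) (h : V → R3) (hh : ContDiff ℝ n h) : ContDiff ℝ n (fun w => h w i) :=
    (EuclideanSpace.proj i : R3 →L[ℝ] ℝ).contDiff.comp hh
  exact ((contDiff_const.mul (hp 2 f hf)).add (contDiff_const.mul (hp 2 g hg))).add
    (contDiff_const.mul (((hp 0 f hf).mul (hp 0 g hg)).add ((hp 1 f hf).mul (hp 1 g hg))))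

theorem extChartAt_prod_symm (p : S2 × S2) (w : E22) :
    (extChartAt I22 p).symm w = ((extChartAt (𝓡 2) p.1).symm w.1, (extChartAt (𝓡 2) p.2).symm w.2) := by
  rw [extChartAt_prod]
  rfl

theorem extChartAt_prod_target (p : S2 × S2) : (extChartAt I22 p).target = univ := by
  rw [extChartAt_prod, PartialEquiv.prod_target, extChartAt_sphere_target,
    extChartAt_sphere_target, univ_prod_univ]

theorem extChartAt_prod_self (p : S2 × S2) : extChartAt I22 p p = (0 : E22) := by
  rw [extChartAt_prod]
  exact Prod.ext (extChartAt_sphere_self p.1) (extChartAt_sphere_self p.2)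

theorem sphereFun_comp_chart (A B C : ℝ) (p : S2 × S2) :
    sphereFun A B C ∘ (extChartAt I22 p).symm
      = fun w : E22 => quadFun A B C (invChart p.1 w.1) (invChart p.2 w.2) := by
  funext w
  rw [Function.comp_apply, extChartAt_prod_symm]
  simp only [sphereFun, coe_extChartAt_symm]

theorem contMDiff_coe_fst : ContMDiff I22 𝓘(ℝ, R3) ω (fun p : S2 × S2 => (p.1 : R3)) :=
  contMDiff_coe_sphere.comp contMDiff_fst

theorem contMDiff_coe_snd : ContMDiff I22 𝓘(ℝ, R3) ω (fun p : S2 × S2 => (p.2 : R3)) :=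
  contMDiff_coe_sphere.comp contMDiff_snd

theorem contMDiff_sphereFun (A B C : ℝ) : ContMDiff I22 𝓘(ℝ, ℝ) ω (sphereFun A B C) := by
  have h : ContDiff ℝ ω (fun w : R3 × R3 => quadFun A B C w.1 w.2) :=
    contDiff_quadFun A B C contDiff_fst contDiff_snd
  exact h.contMDiff.comp (contMDiff_coe_fst.prodMk_space contMDiff_coe_snd)

theorem mvfderiv_coe (p : S2) (v : E2) :
    mvfderiv (𝓡 2) (fun q : S2 => (q : R3)) p v = frame p v := by
  rw [((contMDiff_coe_sphere (m := 1) (n := 2) p).mdifferentiableAt one_ne_zero).mvfderiv]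
  have h : writtenInExtChartAt (𝓡 2) 𝓘(ℝ, R3) p (fun q : S2 => (q : R3)) = invChart p := by
    funext w
    exact coe_extChartAt_symm p w
  rw [h, extChartAt_sphere_self]
  simp [fderiv_invChart_zero]
  rfl

theorem hasFDerivAt_invChart_fst (p : S2) (w : E22) : HasFDerivAt (fun w : E22 => invChart p w.1)
    ((fderiv ℝ (invChart p) w.1).comp (ContinuousLinearMap.fst ℝ E2 E2)) w :=
  (((contDiff_invChart p).differentiable (by simp)) w.1).hasFDerivAt.comp w hasFDerivAt_fst

theorem hasFDerivAt_invChart_snd (p : S2) (w : E22) : HasFDerivAt (fun w : E22 => invChart p w.2)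
    ((fderiv ℝ (invChart p) w.2).comp (ContinuousLinearMap.snd ℝ E2 E2)) w :=
  (((contDiff_invChart p).differentiable (by simp)) w.2).hasFDerivAt.comp w hasFDerivAt_snd

theorem invChart_zero (p : S2) : invChart p 0 = p := by simp [invChart]

theorem mvfderiv_sphereFun (A B C : ℝ) (p : S2 × S2) (v : E22) :
    mvfderiv I22 (sphereFun A B C) p v
      = quadFun A 0 C (frame p.1 v.1) p.2 + quadFun 0 B C p.1 (frame p.2 v.2) := by
  rw [((contMDiff_sphereFun A B C p).mdifferentiableAt (by simp)).mvfderiv]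
  have h : writtenInExtChartAt I22 𝓘(ℝ, ℝ) p (sphereFun A B C)
      = fun w : E22 => quadFun A B C (invChart p.1 w.1) (invChart p.2 w.2) :=
    sphereFun_comp_chart A B C p
  rw [h, extChartAt_prod_self]
  simp only [ModelWithCorners.range_eq_univ, fderivWithin_univ]
  refine (fderiv_quadFun A B C (hasFDerivAt_invChart_fst p.1 0)
    (hasFDerivAt_invChart_snd p.2 0) v).trans ?_
  simp [fderiv_invChart_zero, invChart_zero]

/-- The cross terms come from the ambient second derivative, the others from the curvature of the
spheres. At a critical point the coefficients of the inner products are the Lagrange multipliers. -/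
theorem hessianAt_sphereFun (A B C : ℝ) (p : S2 × S2) (u v : E22) :
    hessianAt I22 (sphereFun A B C) p u v
      = quadFun 0 0 C (frame p.1 u.1) (frame p.2 v.2)
        + quadFun 0 0 C (frame p.1 v.1) (frame p.2 u.2)
        - inner ℝ u.1 v.1 * quadFun A 0 C p.1 p.2 - inner ℝ u.2 v.2 * quadFun 0 B C p.1 p.2 := by
  unfold hessianAt
  rw [sphereFun_comp_chart, extChartAt_prod_self]
  set g : E22 → ℝ := fun w : E22 => quadFun A B C (invChart p.1 w.1) (invChart p.2 w.2) with hg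
  have hc : ContDiff ℝ ω g := contDiff_quadFun A B C
    ((contDiff_invChart p.1).comp contDiff_fst) ((contDiff_invChart p.2).comp contDiff_snd)
  have hd : DifferentiableAt ℝ (fderiv ℝ g) 0 :=
    ((hc.fderiv_right (m := 1) (by simp)).differentiable (by simp)) 0
  have h1 : fderiv ℝ (fderiv ℝ g) 0 u v = fderiv ℝ (fun w => fderiv ℝ g w v) 0 u := by
    rw [fderiv_clm_apply hd (differentiableAt_const v)]
    simp
  have hD (q : S2) (z : E2) : HasFDerivAt (fun w : E2 => fderiv ℝ (invChart q) w z)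
      ((ContinuousLinearMap.apply ℝ R3 z).comp (fderiv ℝ (fderiv ℝ (invChart q)) 0)) 0 :=
    (ContinuousLinearMap.apply ℝ R3 z).hasFDerivAt.comp (0 : E2)
      ((((contDiff_invChart q).fderiv_right (m := 1) (by simp)).differentiable
        (by simp)) 0).hasFDerivAt
  have ha := (hD p.1 v.1).comp (g := fun w : E2 => fderiv ℝ (invChart p.1) w v.1) (0 : E22)
    (hasFDerivAt_fst (𝕜 := ℝ) (p := (0 : E22)))
  have hb := (hD p.2 v.2).comp (g := fun w : E2 => fderiv ℝ (invChart p.2) w v.2) (0 : E22)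
    (hasFDerivAt_snd (𝕜 := ℝ) (p := (0 : E22)))
  have h2 : (fun w => fderiv ℝ g w v) = fun w : E22 =>
      quadFun A 0 C (fderiv ℝ (invChart p.1) w.1 v.1) (invChart p.2 w.2)
        + quadFun 0 B C (invChart p.1 w.1) (fderiv ℝ (invChart p.2) w.2 v.2) := by
    funext w
    exact fderiv_quadFun A B C (hasFDerivAt_invChart_fst p.1 w) (hasFDerivAt_invChart_snd p.2 w) v
  obtain ⟨D₁, h3, h4⟩ := hasFDerivAt_quadFun A 0 C ha (hasFDerivAt_invChart_snd p.2 0)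
  obtain ⟨D₂, h5, h6⟩ := hasFDerivAt_quadFun 0 B C (hasFDerivAt_invChart_fst p.1 0) hb
  refine h1.trans ?_
  rw [h2]
  refine (congrArg (fun φ => φ u) (h3.add h5).fderiv).trans ?_
  rw [add_apply, h4, h6]
  simp [fderiv_invChart_zero, invChart_zero, fderiv_fderiv_invChart_zero, quadFun]
  ring

/-! ### The symplectic form -/

theorem areaForm_apply (p : S2) (u v : E2) :
    areaForm p u v = detForm (p : R3) (frame p u) (frame p v) := by
  rw [← mvfderiv_coe, ← mvfderiv_coe]
  rfl

theorem prodForm_apply (R₁ R₂ : ℝ) (p : S2 × S2) (u v : E22) :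
    prodForm R₁ R₂ p u v = -(R₁ * detForm (p.1 : R3) (frame p.1 u.1) (frame p.1 v.1)
      + R₂ * detForm (p.2 : R3) (frame p.2 u.2) (frame p.2 v.2)) := by
  rw [← areaForm_apply, ← areaForm_apply]
  unfold prodForm
  rw [mfderiv_fst, mfderiv_snd]
  rfl

theorem detForm_coord (x u v : R3) : detForm x u v = x 0 * (u 1 * v 2 - u 2 * v 1)
    + x 1 * (u 2 * v 0 - u 0 * v 2) + x 2 * (u 0 * v 1 - u 1 * v 0) := by
  rw [detForm_apply, Matrix.det_fin_three]
  simp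
  ring

theorem inner_coord (x y : R3) : inner ℝ x y = x 0 * y 0 + x 1 * y 1 + x 2 * y 2 := by
  simp [PiLp.inner_apply, Fin.sum_univ_three]
  ring

theorem sphere_coord (p : S2) :
    (p : R3) 0 ^ 2 + (p : R3) 1 ^ 2 + (p : R3) 2 ^ 2 = 1 := by
  have h : inner ℝ (p : R3) (p : R3) = (1 : ℝ) := by
    rw [real_inner_self_eq_norm_sq, norm_eq_of_mem_sphere]
    norm_num
  rw [inner_coord] at h
  linarith

theorem frame_coord (p : S2) (u : E2) : (p : R3) 0 * frame p u 0 + (p : R3) 1 * frame p u 1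
    + (p : R3) 2 * frame p u 2 = 0 := by
  rw [← inner_coord, inner_frame_self]

theorem frame_inner_coord (p : S2) (u v : E2) : inner ℝ u v = frame p u 0 * frame p v 0
    + frame p u 1 * frame p v 1 + frame p u 2 * frame p v 2 := by
  rw [← inner_coord, inner_frame_frame]

theorem exists_frame_coord (p : S2) (a b c : ℝ)
    (h : (p : R3) 0 * a + (p : R3) 1 * b + (p : R3) 2 * c = 0) :
    ∃ u, frame p u 0 = a ∧ frame p u 1 = b ∧ frame p u 2 = c := by
  obtain ⟨u, hu⟩ := exists_frame_eq p !₂[a, b, c] (by rw [inner_coord]; simpa using h)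
  exact ⟨u, by simp [hu], by simp [hu], by simp [hu]⟩

theorem frame_ext (p : S2) {u v : E2} (h : ∀ i, frame p u i = frame p v i) : u = v :=
  (frame p).injective (PiLp.ext h)

/-- Testing against the tangent vector `p × u` gives `‖u‖²`, up to sign. -/
theorem detForm_frame_nondegenerate (p : S2) (u : E2)
    (h : ∀ v, detForm (p : R3) (frame p u) (frame p v) = 0) : u = 0 := by
  have h1 := frame_coord p u
  have h2 := sphere_coord p
  obtain ⟨v, hv0, hv1, hv2⟩ := exists_frame_coord p
    ((p : R3) 1 * frame p u 2 - (p : R3) 2 * frame p u 1)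
    ((p : R3) 2 * frame p u 0 - (p : R3) 0 * frame p u 2)
    ((p : R3) 0 * frame p u 1 - (p : R3) 1 * frame p u 0) (by ring)
  have h3 := h v
  rw [detForm_coord, hv0, hv1, hv2] at h3
  have h4 : inner ℝ u u = (0 : ℝ) := by
    rw [frame_inner_coord p]
    linear_combination h3 - (frame p u 0 ^ 2 + frame p u 1 ^ 2 + frame p u 2 ^ 2) * h2
      + (p.1 0 * frame p u 0 + p.1 1 * frame p u 1 + p.1 2 * frame p u 2) * h1
  exact inner_self_eq_zero.mp h4

theorem prodForm_alternating (R₁ R₂ : ℝ) (p : S2 × S2) (v : E22) : prodForm R₁ R₂ p v v = 0 := by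
  rw [prodForm_apply, detForm_coord, detForm_coord]
  ring

theorem prodForm_antisymm (R₁ R₂ : ℝ) (p : S2 × S2) (u v : E22) :
    prodForm R₁ R₂ p u v = -prodForm R₁ R₂ p v u := by
  simp only [prodForm_apply, detForm_coord]
  ring

theorem prodForm_nondegenerate {R₁ R₂ : ℝ} (hR₁ : 0 < R₁) (hR₂ : 0 < R₂) (p : S2 × S2) (u : E22)
    (h : ∀ v : E22, prodForm R₁ R₂ p u v = 0) : u = 0 := by
  refine Prod.ext (detForm_frame_nondegenerate p.1 u.1 fun v => ?_)
    (detForm_frame_nondegenerate p.2 u.2 fun v => ?_)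
  · have := h (v, 0)
    rw [prodForm_apply] at this
    simpa [hR₁.ne'] using this
  · have := h (0, v)
    rw [prodForm_apply] at this
    simpa [hR₂.ne'] using this

/-! ### Hamiltonian vector fields and linearizations from non-degeneracy. -/

theorem isInvertible_of_nondegenerate {V : Type*} [NormedAddCommGroup V] [NormedSpace ℝ V]
    [FiniteDimensional ℝ V] (B : V →L[ℝ] V →L[ℝ] ℝ) (h : ∀ v, (∀ w, B v w = 0) → v = 0) :
    B.IsInvertible := by
  have hf : Module.finrank ℝ V = Module.finrank ℝ (V →L[ℝ] ℝ) := by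
    rw [← LinearMap.toContinuousLinearMap.finrank_eq]
    exact (Subspace.dual_finrank_eq (K := ℝ) (V := V)).symm
  have hi : Function.Injective B.toLinearMap := by
    rw [injective_iff_map_eq_zero]
    intro v hv
    exact h v fun w => by simpa using congrArg (fun φ : V →L[ℝ] ℝ => φ w) hv
  refine ⟨(LinearEquiv.ofInjectiveOfFinrankEq B.toLinearMap hi hf).toContinuousLinearEquiv, ?_⟩
  ext v w
  rfl

/-- `ContinuousLinearMap.inverse` is zero on non-invertible maps, so `hamVF` and `linHam` satisfy
their defining equations only thanks to this. -/
theorem isInvertible_prodForm {R₁ R₂ : ℝ} (hR₁ : 0 < R₁) (hR₂ : 0 < R₂) (p : S2 × S2) :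
    ContinuousLinearMap.IsInvertible (prodForm R₁ R₂ p) :=
  isInvertible_of_nondegenerate (V := E22) (prodForm R₁ R₂ p)
    (prodForm_nondegenerate hR₁ hR₂ p)

theorem prodForm_hamVF {R₁ R₂ : ℝ} (hR₁ : 0 < R₁) (hR₂ : 0 < R₂) (f : S2 × S2 → ℝ) (p : S2 × S2)
    (w : E22) : prodForm R₁ R₂ p (hamVF (prodForm R₁ R₂) f p) w = -mvfderiv I22 f p w := by
  unfold hamVF
  rw [map_neg, (isInvertible_prodForm hR₁ hR₂ p).self_apply_inverse]
  rfl

theorem prodForm_linHam {R₁ R₂ : ℝ} (hR₁ : 0 < R₁) (hR₂ : 0 < R₂) (f : S2 × S2 → ℝ) (p : S2 × S2)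
    (v w : E22) : prodForm R₁ R₂ p (linHam (prodForm R₁ R₂) f p v) w = -hessianAt I22 f p v w := by
  unfold linHam
  have h := (isInvertible_prodForm hR₁ hR₂ p).self_apply_inverse (-hessianAt I22 f p v)
  rw [map_neg] at h
  exact congrArg (fun φ : E22 →L[ℝ] ℝ => φ w) h

theorem prodForm_ext {R₁ R₂ : ℝ} (hR₁ : 0 < R₁) (hR₂ : 0 < R₂) (p : S2 × S2) {u u' : E22}
    (h : ∀ v : E22, prodForm R₁ R₂ p u v = prodForm R₁ R₂ p u' v) : u = u' := by
  rw [← sub_eq_zero]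
  refine prodForm_nondegenerate hR₁ hR₂ p _ fun v => ?_
  have := h v
  rw [prodForm_apply, prodForm_apply] at this
  rw [prodForm_apply]
  simp only [Prod.fst_sub, Prod.snd_sub, map_sub, sub_apply]
  linarith

/-- The Hamiltonian vector field of `L` generates the rotations about the vertical axis. -/
theorem frame_hamVF_sysL {R₁ R₂ : ℝ} (hR₁ : 0 < R₁) (hR₂ : 0 < R₂) (p : S2 × S2) (X : E22)
    (hX : X = hamVF (prodForm R₁ R₂) (sysL R₁ R₂) p) :
    (frame p.1 X.1 0 = -(p.1 : R3) 1 ∧ frame p.1 X.1 1 = (p.1 : R3) 0 ∧ frame p.1 X.1 2 = 0) ∧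
    (frame p.2 X.2 0 = -(p.2 : R3) 1 ∧ frame p.2 X.2 1 = (p.2 : R3) 0 ∧ frame p.2 X.2 2 = 0) := by
  obtain ⟨u, hu0, hu1, hu2⟩ := exists_frame_coord p.1 (-(p.1 : R3) 1) ((p.1 : R3) 0) 0 (by ring)
  obtain ⟨v, hv0, hv1, hv2⟩ := exists_frame_coord p.2 (-(p.2 : R3) 1) ((p.2 : R3) 0) 0 (by ring)
  -- By non-degeneracy it suffices that the rotation field satisfies `Ω(·, w) = -dL(w)`.
  have h : X = (u, v) := by
    refine prodForm_ext hR₁ hR₂ p fun w => ?_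
    rw [hX, prodForm_hamVF hR₁ hR₂, sysL_eq, mvfderiv_sphereFun, prodForm_apply, detForm_coord,
      detForm_coord]
    simp only [hu0, hu1, hu2, hv0, hv1, hv2, quadFun]
    have h1 := sphere_coord p.1
    have h2 := sphere_coord p.2
    have h3 := frame_coord p.1 w.1
    have h4 := frame_coord p.2 w.2
    linear_combination (- R₁ * p.1.1 2) * h3 + (-R₂ * p.2.1 2) * h4 + R₁ * frame p.1 w.1 2 * h1
      + R₂ * frame p.2 w.2 2 * h2
  subst h
  exact ⟨⟨hu0, hu1, hu2⟩, ⟨hv0, hv1, hv2⟩⟩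

/-- The bracket is the derivative of `sphereFun A B C` along `X_L`, and both `zᵢ` and `x₁ x₂ + y₁
y₂` are invariant under simultaneous rotation. -/
theorem poissonBracket_eq_zero {R₁ R₂ : ℝ} (hR₁ : 0 < R₁) (hR₂ : 0 < R₂) (A B C : ℝ)
    (p : S2 × S2) :
    poissonBracket (prodForm R₁ R₂) (sysL R₁ R₂) (sphereFun A B C) p = 0 := by
  unfold poissonBracket
  obtain ⟨⟨h0, h1, h2⟩, ⟨h3, h4, h5⟩⟩ := frame_hamVF_sysL hR₁ hR₂ p _ rfl
  refine (prodForm_antisymm R₁ R₂ p _ _).trans ?_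
  refine (congrArg Neg.neg (prodForm_hamVF hR₁ hR₂ _ p _)).trans ?_
  refine (congrArg (fun x => - -x) (mvfderiv_sphereFun A B C p _)).trans ?_
  simp only [quadFun, h0, h1, h2, h3, h4, h5]
  ring

/-- The expression of the area form in the preferred chart at `p`. -/
def chartArea (p : S2) (y : E2) : E2 →L[ℝ] E2 →L[ℝ] ℝ :=
  pullbackBilin (fderiv ℝ (invChart p) y) (detForm (invChart p y))

/-! ### Smoothness and closedness of the form in charts. -/

theorem contDiff_bilin_iff {X V : Type*} [NormedAddCommGroup X] [NormedSpace ℝ X]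
    [NormedAddCommGroup V] [NormedSpace ℝ V] [FiniteDimensional ℝ V] {n : WithTop ℕ∞}
    {B : X → V →L[ℝ] V →L[ℝ] ℝ} :
    ContDiff ℝ n B ↔ ∀ u v, ContDiff ℝ n (fun x => B x u v) := by
  rw [contDiff_clm_apply_iff]
  exact forall_congr' fun u => contDiff_clm_apply_iff

theorem contDiff_pullbackBilin {X V W : Type*} [NormedAddCommGroup X] [NormedSpace ℝ X]
    [NormedAddCommGroup V] [NormedSpace ℝ V] [FiniteDimensional ℝ V]
    [NormedAddCommGroup W] [NormedSpace ℝ W]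
    {n : WithTop ℕ∞} {D : X → V →L[ℝ] W} {B : X → W →L[ℝ] W →L[ℝ] ℝ} (hD : ContDiff ℝ n D)
    (hB : ContDiff ℝ n B) : ContDiff ℝ n (fun x => pullbackBilin (D x) (B x)) :=
  contDiff_bilin_iff.2 fun _ _ =>
    (hB.clm_apply (hD.clm_apply contDiff_const)).clm_apply (hD.clm_apply contDiff_const)

theorem contDiff_detForm {X : Type*} [NormedAddCommGroup X] [NormedSpace ℝ X]
    {n : WithTop ℕ∞} {f : X → R3} (hf : ContDiff ℝ n f) :
    ContDiff ℝ n (fun x => detForm (f x)) := by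
  have hp (i : Fin 3) : ContDiff ℝ n (fun w => f w i) :=
    (EuclideanSpace.proj i : R3 →L[ℝ] ℝ).contDiff.comp hf
  refine contDiff_bilin_iff.2 fun u v => ?_
  simp only [detForm_coord]
  exact (((hp 0).mul contDiff_const).add ((hp 1).mul contDiff_const)).add
    ((hp 2).mul contDiff_const)

theorem contDiff_chartArea (p : S2) : ContDiff ℝ ω (chartArea p) :=
  contDiff_pullbackBilin ((contDiff_invChart p).fderiv_right (by simp))
    (contDiff_detForm (contDiff_invChart p))

theorem chartArea_self (p : S2) (y v : E2) : chartArea p y v v = 0 := by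
  simp only [chartArea, pullbackBilin_apply, detForm_coord]
  ring

theorem fderiv_clm_apply₂ {X V : Type*} [NormedAddCommGroup X] [NormedSpace ℝ X]
    [NormedAddCommGroup V] [NormedSpace ℝ V] {B : X → V →L[ℝ] V →L[ℝ] ℝ} {x : X}
    (hB : DifferentiableAt ℝ B x) (u : X) (v w : V) :
    fderiv ℝ B x u v w = fderiv ℝ (fun x => B x v w) x u := by
  rw [fderiv_clm_apply (hB.clm_apply (differentiableAt_const v)) (differentiableAt_const w),
    fderiv_clm_apply hB (differentiableAt_const v)]
  simp

/-- The cyclic sum is an alternating `3`-form on a plane. This is why every area form on a surface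
is closed. -/
theorem cyclic_sum_eq_zero (T : E2 →L[ℝ] E2 →L[ℝ] E2 →L[ℝ] ℝ) (hT : ∀ u v, T u v v = 0)
    (u v w : E2) : T u v w + T v w u + T w u v = 0 := by
  have hb (x : E2) : x = x 0 • EuclideanSpace.single 0 1 + x 1 • EuclideanSpace.single 1 1 := by
    ext i
    fin_cases i <;> simp
  have hs (u a b : E2) : T u a b = -T u b a := by
    have h := hT u (a + b)
    simp only [map_add, add_apply, hT] at h
    linarith
  set e : E2 := EuclideanSpace.single 0 1
  set f : E2 := EuclideanSpace.single 1 1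
  rw [hb u, hb v, hb w]
  simp only [map_add, map_smul, add_apply, smul_apply, smul_eq_mul, hT, hs _ f e]
  ring

theorem fderiv_chartArea_cyclic (p : S2) (y u v w : E2) :
    fderiv ℝ (chartArea p) y u v w + fderiv ℝ (chartArea p) y v w u
      + fderiv ℝ (chartArea p) y w u v = 0 := by
  refine cyclic_sum_eq_zero _ (fun u v => ?_) u v w
  rw [fderiv_clm_apply₂ (((contDiff_chartArea p).differentiable (by simp)) y)]
  simp only [chartArea_self]
  simp

/-- The expression of the form `prodForm` in the preferred chart at `p`. -/
def chartForm (R₁ R₂ : ℝ) (p : S2 × S2) (x : E22) : E22 →L[ℝ] E22 →L[ℝ] ℝ :=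
  -(R₁ • pullbackBilin (ContinuousLinearMap.fst ℝ E2 E2) (chartArea p.1 x.1)
    + R₂ • pullbackBilin (ContinuousLinearMap.snd ℝ E2 E2) (chartArea p.2 x.2))

theorem contDiff_chartForm (R₁ R₂ : ℝ) (p : S2 × S2) : ContDiff ℝ ω (chartForm R₁ R₂ p) :=
  contDiff_bilin_iff.2 fun u v =>
    ((contDiff_const.mul (contDiff_bilin_iff.1 ((contDiff_chartArea p.1).comp contDiff_fst)
      u.1 v.1)).add (contDiff_const.mul (contDiff_bilin_iff.1
        ((contDiff_chartArea p.2).comp contDiff_snd) u.2 v.2))).neg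

theorem fderiv_chartForm (R₁ R₂ : ℝ) (p : S2 × S2) (x u v w : E22) :
    fderiv ℝ (chartForm R₁ R₂ p) x u v w = -(R₁ * fderiv ℝ (chartArea p.1) x.1 u.1 v.1 w.1
      + R₂ * fderiv ℝ (chartArea p.2) x.2 u.2 v.2 w.2) := by
  rw [fderiv_clm_apply₂ (((contDiff_chartForm R₁ R₂ p).differentiable (by simp)) x)]
  have hd (q : S2) (y : E2) := ((contDiff_chartArea q).differentiable (by simp)) y
  have hs (q : S2) (y a b : E2) : DifferentiableAt ℝ (fun y => chartArea q y a b) y :=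
    ((hd q y).clm_apply (differentiableAt_const a)).clm_apply (differentiableAt_const b)
  have h1 := ((hs p.1 x.1 v.1 w.1).hasFDerivAt.comp x hasFDerivAt_fst).const_mul R₁
  have h2 := ((hs p.2 x.2 v.2 w.2).hasFDerivAt.comp x hasFDerivAt_snd).const_mul R₂
  refine (congrArg (fun φ => φ u) (h1.add h2).neg.fderiv).trans ?_
  rw [fderiv_clm_apply₂ (hd p.1 x.1), fderiv_clm_apply₂ (hd p.2 x.2)]
  rfl

theorem mdifferentiableAt_extChartAt_symm (p : S2 × S2) (x : E22) :
    MDifferentiableAt 𝓘(ℝ, E22) I22 (extChartAt I22 p).symm x := by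
  have h := contMDiffOn_extChartAt_symm (I := I22) (n := 1) p
  rw [extChartAt_prod_target, contMDiffOn_univ] at h
  exact (h x).mdifferentiableAt one_ne_zero

/-- Since `frame` is the derivative of the inclusion into `ℝ³`, tangent vectors can be computed and
compared in the ambient space. -/
theorem frame_mfderiv_fst {E : Type*} [NormedAddCommGroup E] [NormedSpace ℝ E]
    {f : E → S2} {x : E} (hf : MDifferentiableAt 𝓘(ℝ, E) (𝓡 2) f x) (u : E) :
    frame (f x) (mfderiv 𝓘(ℝ, E) (𝓡 2) f x u) = fderiv ℝ (fun y => (f y : R3)) x u := by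
  have h := mfderiv_comp x
    ((contMDiff_coe_sphere (m := 1) (n := 2) (f x)).mdifferentiableAt one_ne_zero) hf
  rw [← mfderiv_eq_fderiv]
  refine Eq.trans ?_ (congrArg (fun φ => φ u) h).symm
  exact (mvfderiv_coe (f x) _).symm

theorem coordForm_prodForm (R₁ R₂ : ℝ) (p : S2 × S2) :
    coordForm (prodForm R₁ R₂) p = chartForm R₁ R₂ p := by
  funext x
  have hx := mdifferentiableAt_extChartAt_symm p x
  have h1 (u : E22) : frame ((extChartAt I22 p).symm x).1
      (Prod.fst (α := E2) (β := E2) (mfderiv 𝓘(ℝ, E22) I22 (extChartAt I22 p).symm x u)) 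
        = fderiv ℝ (invChart p.1) x.1 u.1 := by
    have h := frame_mfderiv_fst (mdifferentiableAt_fst.comp x hx) u
    rw [mfderiv_comp x mdifferentiableAt_fst hx, mfderiv_fst] at h
    refine Eq.trans h ?_
    have h' := (hasFDerivAt_invChart_fst p.1 x).fderiv
    have h'' : (fun y => (((Prod.fst ∘ (extChartAt I22 p).symm) y : S2) : R3))
        = fun w : E22 => invChart p.1 w.1 := by
      funext y
      rw [Function.comp_apply, extChartAt_prod_symm, coe_extChartAt_symm]
    rw [h'', h']
    rfl
  have h2 (u : E22) : frame ((extChartAt I22 p).symm x).2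
      (Prod.snd (α := E2) (β := E2) (mfderiv 𝓘(ℝ, E22) I22 (extChartAt I22 p).symm x u)) 
        = fderiv ℝ (invChart p.2) x.2 u.2 := by
    have h := frame_mfderiv_fst (mdifferentiableAt_snd.comp x hx) u
    rw [mfderiv_comp x mdifferentiableAt_snd hx, mfderiv_snd] at h
    refine Eq.trans h ?_
    have h' := (hasFDerivAt_invChart_snd p.2 x).fderiv
    have h'' : (fun y => (((Prod.snd ∘ (extChartAt I22 p).symm) y : S2) : R3))
        = fun w : E22 => invChart p.2 w.2 := by
      funext y
      rw [Function.comp_apply, extChartAt_prod_symm, coe_extChartAt_symm]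
    rw [h'', h']
    rfl
  have key (u v : E22) : coordForm (prodForm R₁ R₂) p x u v = chartForm R₁ R₂ p x u v := by
    have h3 := prodForm_apply R₁ R₂ ((extChartAt I22 p).symm x)
      (mfderiv 𝓘(ℝ, E22) I22 (extChartAt I22 p).symm x u)
      (mfderiv 𝓘(ℝ, E22) I22 (extChartAt I22 p).symm x v)
    rw [h1, h1, h2, h2, extChartAt_prod_symm, coe_extChartAt_symm, coe_extChartAt_symm] at h3
    exact h3
  exact ContinuousLinearMap.ext fun u => ContinuousLinearMap.ext fun v => key u v

theorem isSymplecticForm_prodForm {R₁ R₂ : ℝ} (hR₁ : 0 < R₁) (hR₂ : 0 < R₂) :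
    IsSymplecticForm (prodForm R₁ R₂) where
  alternating := prodForm_alternating R₁ R₂
  nondegenerate := prodForm_nondegenerate hR₁ hR₂
  smooth p₀ := by
    rw [coordForm_prodForm]
    exact ((contDiff_chartForm R₁ R₂ p₀).of_le le_top).contDiffOn
  closed p₀ x _ u v w := by
    rw [coordForm_prodForm]
    have h1 := fderiv_chartArea_cyclic p₀.1 x.1 u.1 v.1 w.1
    have h2 := fderiv_chartArea_cyclic p₀.2 x.2 u.2 v.2 w.2
    rw [fderiv_chartForm, fderiv_chartForm, fderiv_chartForm]
    linear_combination -R₁ * h1 - R₂ * h2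

/-! ### The circle action -/

/-- The rotation of angle `t` about the vertical axis. -/
def rotate (t : ℝ) (p : S2) : S2 :=
  ⟨!₂[Real.cos t * (p : R3) 0 - Real.sin t * (p : R3) 1,
    Real.sin t * (p : R3) 0 + Real.cos t * (p : R3) 1, (p : R3) 2], by
    have h := sphere_coord p
    have h' := Real.sin_sq_add_cos_sq t
    rw [mem_sphere_zero_iff_norm, EuclideanSpace.norm_eq, Real.sqrt_eq_one]
    simp only [Fin.sum_univ_three, Real.norm_eq_abs, sq_abs]
    simp
    linear_combination h + ((p : R3) 0 ^ 2 + (p : R3) 1 ^ 2) * h'⟩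

theorem hasDerivAt_coe_rotate (p : S2) (t : ℝ) : HasDerivAt (fun t => (rotate t p : R3))
    !₂[-(rotate t p : R3) 1, (rotate t p : R3) 0, 0] t := by
  have hc := Real.hasDerivAt_cos t
  have hs := Real.hasDerivAt_sin t
  have h : HasDerivAt (fun t => (rotate t p : R3).ofLp)
      ![-(rotate t p : R3) 1, (rotate t p : R3) 0, 0] t := by
    rw [hasDerivAt_pi]
    intro i
    fin_cases i
    · refine ((hc.mul_const ((p : R3) 0)).sub (hs.mul_const ((p : R3) 1))).congr_deriv ?_
      simp [rotate]
      ring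
    · refine ((hs.mul_const ((p : R3) 0)).add (hc.mul_const ((p : R3) 1))).congr_deriv ?_
      simp [rotate]
      ring
    · exact hasDerivAt_const t ((p : R3) 2)
  exact (EuclideanSpace.equiv (Fin 3) ℝ).symm.hasFDerivAt.comp_hasDerivAt t h

theorem contMDiff_rotate (p : S2) : ContMDiff 𝓘(ℝ, ℝ) (𝓡 2) 1 (fun t => rotate t p) := by
  have h : ContDiff ℝ 1 (fun t => (rotate t p : R3)) := by
    rw [contDiff_euclidean]
    intro i
    fin_cases i
    · exact (Real.contDiff_cos.mul contDiff_const).sub (Real.contDiff_sin.mul contDiff_const)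
    · exact (Real.contDiff_sin.mul contDiff_const).add (Real.contDiff_cos.mul contDiff_const)
    · exact contDiff_const
  exact h.contMDiff.codRestrict_sphere fun t => (rotate t p).2

theorem frame_mfderiv_rotate (p : S2) (t : ℝ) :
    frame (rotate t p) (mfderiv 𝓘(ℝ, ℝ) (𝓡 2) (fun t => rotate t p) t (1 : ℝ))
      = !₂[-(rotate t p : R3) 1, (rotate t p : R3) 0, 0] := by
  refine (frame_mfderiv_fst ((contMDiff_rotate p t).mdifferentiableAt one_ne_zero) 1).trans ?_
  rw [(hasDerivAt_coe_rotate p t).hasFDerivAt.fderiv]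
  simp

theorem inducesEffectiveCircleAction_sysL {R₁ R₂ : ℝ} (hR₁ : 0 < R₁) (hR₂ : 0 < R₂) :
    InducesEffectiveCircleAction (prodForm R₁ R₂) (sysL R₁ R₂) := by
  refine ⟨fun t p => (rotate t p.1, rotate t p.2), fun p => ⟨?_, fun t => ?_⟩, fun t p => ?_,
    fun t ht => ?_⟩
  · have h (q : S2) : rotate 0 q = q := by
      apply Subtype.ext
      ext i
      fin_cases i <;> simp [rotate]
    simp [h]
  · have hd (q : S2) := ((contMDiff_rotate q t).mdifferentiableAt one_ne_zero).hasMFDerivAt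
    have h := (hd p.1).prodMk (hd p.2)
    have hX := frame_hamVF_sysL hR₁ hR₂ (rotate t p.1, rotate t p.2) _ rfl
    obtain ⟨⟨h0, h1, h2⟩, ⟨h3, h4, h5⟩⟩ := hX
    have hext (D D' : ℝ →L[ℝ] E22) (hD : D 1 = D' 1) : D = D' := ContinuousLinearMap.ext_ring hD
    refine h.congr_mfderiv (hext _ _ (Eq.trans ?_ (one_smul ℝ
      (hamVF (prodForm R₁ R₂) (sysL R₁ R₂) (rotate t p.1, rotate t p.2))).symm))
    refine Eq.symm (Prod.ext (frame_ext (rotate t p.1) fun i => ?_)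
      (frame_ext (rotate t p.2) fun i => ?_))
    · refine Eq.trans ?_ (congrArg (fun x : R3 => x i) (frame_mfderiv_rotate p.1 t)).symm
      fin_cases i
      · exact h0
      · exact h1
      · exact h2
    · refine Eq.trans ?_ (congrArg (fun x : R3 => x i) (frame_mfderiv_rotate p.2 t)).symm
      fin_cases i
      · exact h3
      · exact h4
      · exact h5
  · simp [rotate]
  -- An equatorial point has trivial stabilizer; its first coordinate after rotation is already `cos
  -- t`.
  · let e : S2 := ⟨!₂[1, 0, 0], by simp [EuclideanSpace.norm_eq, Fin.sum_univ_three]⟩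
    have h := congrArg (fun q : S2 × S2 => (q.1 : R3) 0) (ht (e, e))
    have h' : Real.cos t = 1 := by simpa [rotate, e] using h
    obtain ⟨n, hn⟩ := (Real.cos_eq_one_iff t).mp h'
    exact ⟨n, hn.symm⟩

/-! ### Critical combinations -/

theorem exists_combination_eq_zero {M : Type*} [AddCommGroup M] [Module ℝ M] {x y : M}
    (h : Module.finrank ℝ (Submodule.span ℝ {x, y}) < 2) :
    ∃ a b : ℝ, (a ≠ 0 ∨ b ≠ 0) ∧ a • x + b • y = 0 := by
  by_contra! hc
  have hl : LinearIndependent ℝ ![x, y] := by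
    rw [LinearIndependent.pair_iff]
    intro s t hst
    by_contra hne
    exact hc s t (by tauto) hst
  have := finrank_span_eq_card hl
  rw [Matrix.range_cons, Matrix.range_cons, Matrix.range_empty, union_empty, singleton_union,
    Fintype.card_fin] at this
  exact h.ne this

theorem mvfderiv_combination (a b A B C A' B' C' : ℝ) (p : S2 × S2) :
    a • mvfderiv I22 (sphereFun A B C) p + b • mvfderiv I22 (sphereFun A' B' C') p
      = mvfderiv I22 (sphereFun (a * A + b * A') (a * B + b * B') (a * C + b * C')) p := by
  refine ContinuousLinearMap.ext fun v => ?_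
  have h1 := mvfderiv_sphereFun A B C p v
  have h2 := mvfderiv_sphereFun A' B' C' p v
  have h3 := mvfderiv_sphereFun (a * A + b * A') (a * B + b * B') (a * C + b * C') p v
  refine Eq.trans ?_ h3.symm
  refine (congrArg₂ (fun x y => a * x + b * y) h1 h2).trans ?_
  simp only [quadFun]
  ring

theorem eq_smul_of_frame_orthogonal (p : S2) (a b c : ℝ)
    (h : ∀ v, a * frame p v 0 + b * frame p v 1 + c * frame p v 2 = 0) :
    ∃ l, l = a * (p : R3) 0 + b * (p : R3) 1 + c * (p : R3) 2 ∧
      a = l * (p : R3) 0 ∧ b = l * (p : R3) 1 ∧ c = l * (p : R3) 2 := by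
  refine ⟨_, rfl, ?_⟩
  have hp := sphere_coord p
  set l := a * (p : R3) 0 + b * (p : R3) 1 + c * (p : R3) 2 with hl
  obtain ⟨u, h0, h1, h2⟩ := exists_frame_coord p (a - l * (p : R3) 0) (b - l * (p : R3) 1)
    (c - l * (p : R3) 2) (by linear_combination -hl - l * hp)
  have hu := h u
  rw [h0, h1, h2] at hu
  have hs : (a - l * (p : R3) 0) ^ 2 + (b - l * (p : R3) 1) ^ 2 + (c - l * (p : R3) 2) ^ 2 = 0 := by
    linear_combination hu + l * hl + l ^ 2 * hp
  refine ⟨?_, ?_, ?_⟩ <;> rw [← sub_eq_zero, ← sq_eq_zero_iff] <;>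
    nlinarith [sq_nonneg (a - l * (p : R3) 0), sq_nonneg (b - l * (p : R3) 1),
      sq_nonneg (c - l * (p : R3) 2)]

/-- Lagrange multipliers: each partial gradient is normal to its sphere, and the multiplier is read
off by pairing it with the point. -/
theorem critical_equations {A B C : ℝ} {p : S2 × S2} (h : mvfderiv I22 (sphereFun A B C) p = 0) :
    ∃ l m : ℝ, l = quadFun A 0 C p.1 p.2 ∧ m = quadFun 0 B C p.1 p.2 ∧
      (C * (p.2 : R3) 0 = l * (p.1 : R3) 0 ∧ C * (p.2 : R3) 1 = l * (p.1 : R3) 1 ∧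
        A = l * (p.1 : R3) 2) ∧
      (C * (p.1 : R3) 0 = m * (p.2 : R3) 0 ∧ C * (p.1 : R3) 1 = m * (p.2 : R3) 1 ∧
        B = m * (p.2 : R3) 2) := by
  have hv (v : E22) : quadFun A 0 C (frame p.1 v.1) p.2 + quadFun 0 B C p.1 (frame p.2 v.2) = 0 :=
    (mvfderiv_sphereFun A B C p v).symm.trans (congrArg (fun φ : E22 →L[ℝ] ℝ => φ v) h)
  simp only [quadFun] at hv
  obtain ⟨l, hl, hl'⟩ := eq_smul_of_frame_orthogonal p.1 (C * (p.2 : R3) 0) (C * (p.2 : R3) 1) A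
    (fun v => by have := hv (v, 0); simp at this; linarith)
  obtain ⟨m, hm, hm'⟩ := eq_smul_of_frame_orthogonal p.2 (C * (p.1 : R3) 0) (C * (p.1 : R3) 1) B
    (fun v => by have := hv (0, v); simp at this; linarith)
  refine ⟨l, m, ?_, ?_, hl', hm'⟩
  · rw [hl, quadFun]
    ring
  · rw [hm, quadFun]
    ring

/-- At a singularity, some non-trivial combination of `L` and `H` is critical. -/
theorem exists_critical_of_singular {R₁ R₂ A B C : ℝ} {p : S2 × S2}
    (h : IsSingularPt I22 (sysL R₁ R₂) (sphereFun A B C) p) :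
    ∃ a b : ℝ, (a ≠ 0 ∨ b ≠ 0) ∧
      mvfderiv I22 (sphereFun (a * R₁ + b * A) (a * R₂ + b * B) (b * C)) p = 0 := by
  obtain ⟨a, b, hab, h0⟩ := exists_combination_eq_zero h
  refine ⟨a, b, hab, ?_⟩
  rw [sysL_eq, mvfderiv_combination] at h0
  simpa using h0

/-- With non-zero coupling `b C` the multiplier equations make the horizontal parts proportional.
With zero coupling a non-zero multiplier forces one point to be a pole, and `hC` excludes that both
multipliers vanish. -/
theorem collinear_of_singular {R₁ R₂ A B C : ℝ} (hR₁ : 0 < R₁)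
    (hC : C = 0 → A * R₂ ≠ B * R₁) {p : S2 × S2}
    (h : IsSingularPt I22 (sysL R₁ R₂) (sphereFun A B C) p) :
    (p.1 : R3) 0 * (p.2 : R3) 1 - (p.1 : R3) 1 * (p.2 : R3) 0 = 0 := by
  obtain ⟨a, b, hab, h0⟩ := exists_critical_of_singular h
  obtain ⟨l, m, -, -, ⟨h1, h2, h3⟩, ⟨h4, h5, h6⟩⟩ := critical_equations h0
  by_cases hbC : b * C = 0
  · rw [hbC] at h1 h2 h4 h5
    simp only [zero_mul, zero_eq_mul] at h1 h2 h4 h5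
    by_cases hl : l = 0
    · by_cases hm : m = 0
      · exfalso
        subst hl hm
        rcases mul_eq_zero.1 hbC with hb | hC'
        · subst hb
          rcases hab with ha | ha
          · have : a * R₁ = 0 := by linarith
            rcases mul_eq_zero.1 this with h' | h' <;> [exact ha h'; exact hR₁.ne' h']
          · exact ha rfl
        · have h7 : b * (A * R₂ - B * R₁) = 0 := by linear_combination R₂ * h3 - R₁ * h6
          rcases mul_eq_zero.1 h7 with hb | hb
          · subst hb
            rcases hab with ha | ha
            · have : a * R₁ = 0 := by linarith
              rcases mul_eq_zero.1 this with h' | h' <;> [exact ha h'; exact hR₁.ne' h']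
            · exact ha rfl
          · exact hC hC' (sub_eq_zero.1 hb)
      · rw [h4.resolve_left hm, h5.resolve_left hm]
        ring
    · rw [h1.resolve_left hl, h2.resolve_left hl]
      ring
  · refine (mul_eq_zero.1 ?_).resolve_left hbC
    linear_combination (p.1 : R3) 0 * h2 - (p.1 : R3) 1 * h1

/-! ### The singularities form a null set -/

/-- Stereographic projection sends a great circle to a line if it passes through the centre `p` of
the chart, and to a circle otherwise. -/
theorem volume_invChart_inner_eq_zero (p : S2) {n : R3} (hn : n ≠ 0) :
    volume {w : E2 | (inner ℝ n (invChart p w) : ℝ) = 0} = 0 := by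
  set t : ℝ := inner ℝ (p : R3) n with ht
  obtain ⟨m, hm⟩ := exists_frame_eq p (n - t • (p : R3)) (by
    rw [inner_sub_right, inner_smul_right, real_inner_self_eq_norm_sq, norm_eq_of_mem_sphere]
    simp [ht])
  have hn' : n = frame p m + t • (p : R3) := by rw [hm]; simp
  have key (w : E2) (hw : (inner ℝ n (invChart p w) : ℝ) = 0) :
      4 * inner ℝ m w + (4 - ‖w‖ ^ 2) * t = 0 := by
    rw [invChart, inner_smul_right, mul_eq_zero] at hw
    have h := hw.resolve_left (by positivity)
    rw [hn', inner_add_right, inner_smul_right, inner_smul_right, inner_add_left, inner_add_left,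
      inner_smul_left, inner_smul_left, inner_frame_frame, real_inner_comm, inner_frame_self,
      real_inner_comm (p : R3) (frame p m), inner_frame_self, real_inner_self_eq_norm_sq,
      norm_eq_of_mem_sphere, real_inner_comm] at h
    simp at h
    linarith
  by_cases h0 : t = 0
  · have hm0 : m ≠ 0 := by
      rintro rfl
      exact hn (by simp [hn', h0])
    refine measure_mono_null (t := ((ℝ ∙ m)ᗮ : Submodule ℝ E2)) (fun w hw => ?_)
      (Measure.addHaar_submodule volume _ fun h => hm0 ?_)
    · have := key w hw
      rw [h0] at this
      rw [SetLike.mem_coe, Submodule.mem_orthogonal_singleton_iff_inner_right]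
      linarith
    · have hmem : m ∈ (ℝ ∙ m)ᗮ := h ▸ Submodule.mem_top
      rw [Submodule.mem_orthogonal_singleton_iff_inner_right] at hmem
      exact inner_self_eq_zero.mp hmem
  -- Centre and radius come from completing the square in `4 ⟪m, w⟫ + (4 - ‖w‖²) t = 0`.
  · refine measure_mono_null (t := Metric.sphere ((2 / t) • m) (√(4 + ‖(2 / t) • m‖ ^ 2)))
      (fun w hw => ?_) (Measure.addHaar_sphere volume _ _)
    rw [mem_sphere_iff_norm, eq_comm, Real.sqrt_eq_iff_mul_self_eq (by positivity) (norm_nonneg _),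
      ← sq, norm_sub_sq_real, inner_smul_right, real_inner_comm]
    have := key w hw
    field_simp
    linear_combination this

theorem continuous_invChart (p : S2) : Continuous (invChart p) := (contDiff_invChart p).continuous

/-- Fubini: once `x₁ ≠ 0`, which holds almost everywhere, the condition on the second point defines
a great circle. -/
theorem volume_collinear_eq_zero (p : S2 × S2) :
    (volume.prod volume) {w : E22 | invChart p.1 w.1 0 * invChart p.2 w.2 1
      - invChart p.1 w.1 1 * invChart p.2 w.2 0 = 0} = 0 := by
  have hc (i : Fin 3) (q : S2) : Continuous fun w => invChart q w i :=
    (EuclideanSpace.proj i : R3 →L[ℝ] ℝ).continuous.comp (continuous_invChart q)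
  have hcl : IsClosed {w : E22 | invChart p.1 w.1 0 * invChart p.2 w.2 1
      - invChart p.1 w.1 1 * invChart p.2 w.2 0 = 0} :=
    isClosed_eq ((((hc 0 p.1).comp continuous_fst).mul ((hc 1 p.2).comp continuous_snd)).sub
      (((hc 1 p.1).comp continuous_fst).mul ((hc 0 p.2).comp continuous_snd))) continuous_const
  rw [Measure.measure_prod_null hcl.measurableSet]
  have h0 : ∀ᵐ w : E2, (inner ℝ (EuclideanSpace.single 0 1 : R3) (invChart p.1 w) : ℝ) ≠ 0 := by
    have := volume_invChart_inner_eq_zero p.1 (n := EuclideanSpace.single 0 1) (by simp)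
    rw [ae_iff]
    simpa using this
  filter_upwards [h0] with w hw
  have hn : (!₂[-invChart p.1 w 1, invChart p.1 w 0, 0] : R3) ≠ 0 := by
    intro h
    have := congrArg (fun x : R3 => x 1) h
    simp at this
    exact hw (by simp [inner_coord, this])
  refine measure_mono_null (fun z hz => ?_) (volume_invChart_inner_eq_zero p.2 hn)
  have hz' : invChart p.1 w 0 * invChart p.2 z 1 - invChart p.1 w 1 * invChart p.2 z 0 = 0 := hz
  rw [mem_ofPred_eq, inner_coord]
  simp
  linarith

theorem isNullInCharts_singular {R₁ R₂ A B C : ℝ} (hR₁ : 0 < R₁)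
    (hC : C = 0 → A * R₂ ≠ B * R₁) :
    IsNullInCharts I22 {p : S2 × S2 | IsSingularPt I22 (sysL R₁ R₂) (sphereFun A B C) p} := by
  intro μ _ p
  -- Nullity for one additive Haar measure is nullity for all of them.
  have hμ : μ ≪ (volume.prod volume : Measure E22) :=
    Measure.absolutelyContinuous_isAddHaarMeasure _ _
  refine hμ (measure_mono_null (fun w hw => ?_) (volume_collinear_eq_zero p))
  have h := collinear_of_singular hR₁ hC hw.2
  rw [extChartAt_prod_symm, coe_extChartAt_symm, coe_extChartAt_symm] at h
  exact h

instance connectedSpace_S2 : ConnectedSpace S2 := by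
  refine isConnected_iff_connectedSpace.1 (isConnected_sphere ?_ 0 zero_le_one)
  rw [← Module.finrank_eq_rank, finrank_euclideanSpace_fin]
  norm_num

theorem isCompletelyIntegrable_sphereFun {R₁ R₂ A B C : ℝ} (hR₁ : 0 < R₁) (hR₂ : 0 < R₂)
    (hC : C = 0 → A * R₂ ≠ B * R₁) :
    IsCompletelyIntegrable (prodForm R₁ R₂) (sysL R₁ R₂) (sphereFun A B C) where
  connected := inferInstance
  dim_eq := by simp
  symplectic := isSymplecticForm_prodForm hR₁ hR₂
  smooth_fst := by
    rw [sysL_eq]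
    exact (contMDiff_sphereFun _ _ _).of_le le_top
  smooth_snd := (contMDiff_sphereFun _ _ _).of_le le_top
  rank_ae := isNullInCharts_singular hR₁ hC
  commute := poissonBracket_eq_zero hR₁ hR₂ A B C

theorem isCompact_preimage_sysL (R₁ R₂ : ℝ) (S : Set ℝ) (hS : IsCompact S) :
    IsCompact (sysL R₁ R₂ ⁻¹' S) := by
  have h : Continuous (sysL R₁ R₂) := by
    rw [sysL_eq]
    exact (contMDiff_sphereFun _ _ _).continuous
  exact (hS.isClosed.preimage h).isCompact

/-! ### Singularities of rank one -/

/-- The point `p` is a pole. -/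
def IsPole (p : S2) : Prop := (p : R3) 0 = 0 ∧ (p : R3) 1 = 0

theorem isPole_iff (p : S2) : IsPole p ↔ p = northPole ∨ p = southPole := by
  constructor
  · rintro ⟨h0, h1⟩
    have h := sphere_coord p
    have h2 : ((p : R3) 2 - 1) * ((p : R3) 2 + 1) = 0 := by
      rw [h0, h1] at h
      linear_combination h
    rcases mul_eq_zero.1 h2 with h2 | h2
    · left
      apply Subtype.ext
      ext i
      fin_cases i
      · simpa [northPole] using h0
      · simpa [northPole] using h1
      · simpa [northPole, sub_eq_zero] using h2
    · right
      apply Subtype.ext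
      ext i
      fin_cases i
      · simpa [southPole] using h0
      · simpa [southPole] using h1
      · simpa [southPole] using eq_neg_of_add_eq_zero_left h2
  · rintro (rfl | rfl) <;> simp [IsPole, northPole, southPole]

theorem IsPole.frame_eq_zero {p : S2} (hp : IsPole p) (v : E2) : frame p v 2 = 0 := by
  have h := frame_coord p v
  have h' := sphere_coord p
  rw [hp.1, hp.2] at h h'
  have hz : (p : R3) 2 ≠ 0 := by
    intro h0
    rw [h0] at h'
    norm_num at h'
  have h3 : (p : R3) 2 * frame p v 2 = 0 := by linarith
  exact (mul_eq_zero.1 h3).resolve_left hz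

theorem mvfderiv_sphereFun_eq_zero (A B C : ℝ) {p : S2 × S2} (h₁ : IsPole p.1) (h₂ : IsPole p.2) :
    mvfderiv I22 (sphereFun A B C) p = 0 := by
  have h (D : E22 →L[ℝ] ℝ) (hD : ∀ v, D v = 0) : D = 0 := ContinuousLinearMap.ext hD
  refine h _ fun v => (mvfderiv_sphereFun A B C p v).trans ?_
  simp [quadFun, h₁.frame_eq_zero, h₂.frame_eq_zero, h₁.1, h₁.2, h₂.1, h₂.2]

theorem isPole_of_mvfderiv_sysL {R₁ R₂ : ℝ} (hR₁ : 0 < R₁) (hR₂ : 0 < R₂) {p : S2 × S2}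
    (h : mvfderiv I22 (sysL R₁ R₂) p = 0) : IsPole p.1 ∧ IsPole p.2 := by
  rw [sysL_eq] at h
  obtain ⟨l, m, -, -, ⟨h1, h2, h3⟩, ⟨h4, h5, h6⟩⟩ := critical_equations h
  have hl : l ≠ 0 := by
    rintro rfl
    linarith
  have hm : m ≠ 0 := by
    rintro rfl
    linarith
  simp only [zero_mul, zero_eq_mul] at h1 h2 h4 h5
  exact ⟨⟨h1.resolve_left hl, h2.resolve_left hl⟩, ⟨h4.resolve_left hm, h5.resolve_left hm⟩⟩

theorem rankAt_of_isPole (R₁ R₂ A B C : ℝ) {p : S2 × S2} (h₁ : IsPole p.1) (h₂ : IsPole p.2) :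
    rankAt I22 (sysL R₁ R₂) (sphereFun A B C) p = 0 := by
  have h (f g : E22 →L[ℝ] ℝ) (hf : f = 0) (hg : g = 0) :
      Module.finrank ℝ (Submodule.span ℝ {f, g}) = 0 := by
    subst hf hg
    simp
  rw [sysL_eq]
  exact h _ _ (mvfderiv_sphereFun_eq_zero _ _ _ h₁ h₂) (mvfderiv_sphereFun_eq_zero _ _ _ h₁ h₂)

theorem finrank_span_pair_pos {M : Type*} [AddCommGroup M] [Module ℝ M] {x y : M} (hx : x ≠ 0) :
    0 < Module.finrank ℝ (Submodule.span ℝ {x, y}) := by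
  have : FiniteDimensional ℝ (Submodule.span ℝ {x, y}) :=
    FiniteDimensional.span_of_finite ℝ (by simp)
  rw [Module.finrank_pos_iff]
  exact ⟨⟨x, Submodule.subset_span (by simp)⟩, 0, fun h => hx (congrArg Subtype.val h)⟩

theorem rankAt_eq_one {R₁ R₂ A B C : ℝ} (hR₁ : 0 < R₁) (hR₂ : 0 < R₂) {p : S2 × S2}
    (hp : ¬ (IsPole p.1 ∧ IsPole p.2))
    (hs : IsSingularPt I22 (sysL R₁ R₂) (sphereFun A B C) p) :
    rankAt I22 (sysL R₁ R₂) (sphereFun A B C) p = 1 := by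
  have h : 0 < rankAt I22 (sysL R₁ R₂) (sphereFun A B C) p :=
    finrank_span_pair_pos fun h => hp (isPole_of_mvfderiv_sysL hR₁ hR₂ h)
  have h' : rankAt I22 (sysL R₁ R₂) (sphereFun A B C) p < 2 := hs
  omega

/-- The second derivative of a critical combination is definite transversally to the orbits of
the circle action. -/
theorem exists_definite_of_critical {R₁ R₂ A B C : ℝ} {p : S2 × S2}
    (hp : ¬ (IsPole p.1 ∧ IsPole p.2)) (hC : C = 0 → A ≠ 0 ∨ B ≠ 0) (hR₁ : 0 < R₁) (hR₂ : 0 < R₂)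
    (h : mvfderiv I22 (sphereFun A B C) p = 0) :
    ∃ σ : ℝ, σ ≠ 0 ∧ ∀ v : E22, R₁ * frame p.1 v.1 2 + R₂ * frame p.2 v.2 2 = 0 →
      0 < σ * hessianAt I22 (sphereFun A B C) p v v ∨
      ∃ t : ℝ, (frame p.1 v.1 0 = t * -(p.1 : R3) 1 ∧ frame p.1 v.1 1 = t * (p.1 : R3) 0 ∧
          frame p.1 v.1 2 = 0) ∧
        (frame p.2 v.2 0 = t * -(p.2 : R3) 1 ∧ frame p.2 v.2 1 = t * (p.2 : R3) 0 ∧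
          frame p.2 v.2 2 = 0) := by
  obtain ⟨l, m, hl, hm, ⟨h1, h2, h3⟩, ⟨h4, h5, h6⟩⟩ := critical_equations h
  have hess (v : E22) : hessianAt I22 (sphereFun A B C) p v v =
      2 * C * (frame p.1 v.1 0 * frame p.2 v.2 0 + frame p.1 v.1 1 * frame p.2 v.2 1)
      - l * (frame p.1 v.1 0 ^ 2 + frame p.1 v.1 1 ^ 2 + frame p.1 v.1 2 ^ 2)
      - m * (frame p.2 v.2 0 ^ 2 + frame p.2 v.2 1 ^ 2 + frame p.2 v.2 2 ^ 2) := by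
    rw [hessianAt_sphereFun, ← hl, ← hm, frame_inner_coord p.1, frame_inner_coord p.2]
    simp only [quadFun]
    ring
  -- Off the poles, horizontal tangent vectors are multiples of the rotation field.
  have tang (q : S2) (hq : ¬ IsPole q) (v : E2) (hv : frame q v 2 = 0) : ∃ t : ℝ,
      frame q v 0 = t * -(q : R3) 1 ∧ frame q v 1 = t * (q : R3) 0 := by
    have hr : (q : R3) 0 ^ 2 + (q : R3) 1 ^ 2 ≠ 0 := by
      intro h0
      exact hq ⟨by nlinarith [sq_nonneg ((q : R3) 0), sq_nonneg ((q : R3) 1)],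
        by nlinarith [sq_nonneg ((q : R3) 0), sq_nonneg ((q : R3) 1)]⟩
    have hf := frame_coord q v
    rw [hv] at hf
    refine ⟨((q : R3) 0 * frame q v 1 - (q : R3) 1 * frame q v 0) /
      ((q : R3) 0 ^ 2 + (q : R3) 1 ^ 2), ?_, ?_⟩
    · field_simp
      linear_combination (q : R3) 0 * hf
    · field_simp
      linear_combination (q : R3) 1 * hf
  -- Without coupling, exactly one of the points is a pole. The multiplier at the other one
  -- vanishes, so the Hessian is a multiple of the squared norm of the component at the pole.
  by_cases hC0 : C = 0
  · subst hC0
    simp only [zero_mul, zero_eq_mul] at h1 h2 h4 h5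
    have hlm : l = 0 ∨ IsPole p.1 := by
      by_cases hl0 : l = 0
      · exact Or.inl hl0
      · exact Or.inr ⟨h1.resolve_left hl0, h2.resolve_left hl0⟩
    have hlm' : m = 0 ∨ IsPole p.2 := by
      by_cases hm0 : m = 0
      · exact Or.inl hm0
      · exact Or.inr ⟨h4.resolve_left hm0, h5.resolve_left hm0⟩
    by_cases hp1 : IsPole p.1
    · have hp2 : ¬ IsPole p.2 := fun hp2 => hp ⟨hp1, hp2⟩
      have hm0 := hlm'.resolve_right hp2
      subst hm0
      have hl0 : l ≠ 0 := by
        rintro rfl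
        simp [h3, h6] at hC
      refine ⟨-l, neg_ne_zero.2 hl0, fun v hv => ?_⟩
      rw [hp1.frame_eq_zero, mul_zero, zero_add] at hv
      have hv2 := (mul_eq_zero.1 hv).resolve_left hR₂.ne'
      by_cases hv1 : v.1 = 0
      · right
        obtain ⟨t, ht⟩ := tang p.2 hp2 v.2 hv2
        exact ⟨t, by simp [hv1, hp1.1, hp1.2], ht.1, ht.2, hv2⟩
      · left
        have hpos : 0 < inner ℝ v.1 v.1 := real_inner_self_pos.2 hv1
        rw [frame_inner_coord p.1] at hpos
        rw [hess]
        have := mul_pos (sq_pos_of_ne_zero hl0) hpos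
        linarith
    · have hl0 := hlm.resolve_right hp1
      subst hl0
      have hm0 : m ≠ 0 := by
        rintro rfl
        simp [h3, h6] at hC
      have hp2 := hlm'.resolve_left hm0
      refine ⟨-m, neg_ne_zero.2 hm0, fun v hv => ?_⟩
      rw [hp2.frame_eq_zero, mul_zero, add_zero] at hv
      have hv1 := (mul_eq_zero.1 hv).resolve_left hR₁.ne'
      by_cases hv2 : v.2 = 0
      · right
        obtain ⟨t, ht⟩ := tang p.1 hp1 v.1 hv1
        exact ⟨t, ⟨ht.1, ht.2, hv1⟩, by simp [hv2, hp2.1, hp2.2]⟩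
      · left
        have hpos : 0 < inner ℝ v.2 v.2 := real_inner_self_pos.2 hv2
        rw [frame_inner_coord p.2] at hpos
        rw [hess]
        have := mul_pos (sq_pos_of_ne_zero hm0) hpos
        linarith
  · have hp1 : ¬ IsPole p.1 := fun hp1 => hp ⟨hp1, by simpa [hp1.1, hC0] using h1,
      by simpa [hp1.2, hC0] using h2⟩
    -- The horizontal parts satisfy `C p₂ = l p₁` and `C p₁ = m p₂`, with `p₁` not vertical.
    have hlmC : l * m = C ^ 2 := by
      have e0 : (l * m - C ^ 2) * (p.1 : R3) 0 = 0 := by linear_combination -m * h1 - C * h4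
      have e1 : (l * m - C ^ 2) * (p.1 : R3) 1 = 0 := by linear_combination -m * h2 - C * h5
      by_contra hne
      exact hp1 ⟨(mul_eq_zero.1 e0).resolve_left (sub_ne_zero.2 hne),
        (mul_eq_zero.1 e1).resolve_left (sub_ne_zero.2 hne)⟩
    have hl0 : l ≠ 0 := by
      rintro rfl
      rw [zero_mul] at hlmC
      exact hC0 (pow_eq_zero_iff two_ne_zero |>.1 hlmC.symm)
    refine ⟨-l, neg_ne_zero.2 hl0, fun v hv => ?_⟩
    -- Completing the square, with `l m = C²` turning the last coefficient into `C²`.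
    have hQ : -l * hessianAt I22 (sphereFun A B C) p v v
        = (l * frame p.1 v.1 0 - C * frame p.2 v.2 0) ^ 2
          + (l * frame p.1 v.1 1 - C * frame p.2 v.2 1) ^ 2
          + (l * frame p.1 v.1 2) ^ 2 + (C * frame p.2 v.2 2) ^ 2 := by
      rw [hess]
      linear_combination (frame p.2 v.2 0 ^ 2 + frame p.2 v.2 1 ^ 2 + frame p.2 v.2 2 ^ 2) * hlmC
    rw [hQ]
    by_cases hz : (l * frame p.1 v.1 0 - C * frame p.2 v.2 0 = 0
        ∧ l * frame p.1 v.1 1 - C * frame p.2 v.2 1 = 0)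
        ∧ (l * frame p.1 v.1 2 = 0 ∧ C * frame p.2 v.2 2 = 0)
    · right
      obtain ⟨⟨z0, z1⟩, z2, z3⟩ := hz
      have hv1 := (mul_eq_zero.1 z2).resolve_left hl0
      have hv2 := (mul_eq_zero.1 z3).resolve_left hC0
      obtain ⟨t, ht0, ht1⟩ := tang p.1 hp1 v.1 hv1
      refine ⟨t, ⟨ht0, ht1, hv1⟩, mul_left_cancel₀ hC0 ?_, mul_left_cancel₀ hC0 ?_, hv2⟩
      · linear_combination -z0 + l * ht0 - (-t) * h2
      · linear_combination -z1 + l * ht1 - t * h1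
    · left
      have pos {x : ℝ} (hx : x ≠ 0) : 0 < x ^ 2 := sq_pos_of_ne_zero hx
      rw [not_and_or, not_and_or, not_and_or] at hz
      rcases hz with (hz | hz) | (hz | hz)
      · have := pos hz
        positivity
      · have := pos hz
        positivity
      · have := pos hz
        positivity
      · have := pos hz
        positivity

/-- The orthogonal `ℓ'` lies in `ker dL` because `X_L` spans part of `ℓ`. Definiteness transverse to
`ℓ` gives both the type and the non-degeneracy. -/
theorem isEllipticRegular_of_singular {R₁ R₂ A B C : ℝ} (hR₁ : 0 < R₁) (hR₂ : 0 < R₂)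
    (hC : C = 0 → A * R₂ ≠ B * R₁) {p : S2 × S2} (hp : ¬ (IsPole p.1 ∧ IsPole p.2))
    (hs : IsSingularPt I22 (sysL R₁ R₂) (sphereFun A B C) p) :
    IsEllipticRegular (prodForm R₁ R₂) (sysL R₁ R₂) (sphereFun A B C) p := by
  obtain ⟨a, b, hab, h0⟩ := exists_critical_of_singular hs
  have hC' : b * C = 0 → a * R₁ + b * A ≠ 0 ∨ a * R₂ + b * B ≠ 0 := by
    intro hbC
    by_contra! hcon
    have h7 : b * (A * R₂ - B * R₁) = 0 := by linear_combination R₂ * hcon.1 - R₁ * hcon.2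
    have hb : b = 0 := by
      rcases mul_eq_zero.1 hbC with hb | hC'
      · exact hb
      · exact (mul_eq_zero.1 h7).resolve_right (sub_ne_zero.2 (hC hC'))
    rw [hb, zero_mul, add_zero] at hcon
    have ha := (mul_eq_zero.1 hcon.1).resolve_right hR₁.ne'
    exact hab.elim (fun h => h ha) (fun h => h hb)
  obtain ⟨σ, hσ, hdef⟩ := exists_definite_of_critical hp hC' hR₁ hR₂ h0
  -- The factor `σ` is absorbed into the combination, which makes the transverse Hessian positive.
  have hcrit : IsCriticalCombination I22 (sysL R₁ R₂) (sphereFun A B C) p (σ * a) (σ * b) := by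
    refine ⟨hab.imp (mul_ne_zero hσ) (mul_ne_zero hσ), ?_⟩
    have h1 := mvfderiv_combination a b R₁ R₂ 0 A B C p
    rw [mul_zero, zero_add, h0] at h1
    rw [sysL_eq, mul_smul, mul_smul, ← smul_add, h1, smul_zero]
  have hfun : (fun q => σ * a * sysL R₁ R₂ q + σ * b * sphereFun A B C q)
      = sphereFun (σ * (a * R₁ + b * A)) (σ * (a * R₂ + b * B)) (σ * (b * C)) := by
    rw [sysL_eq, sphereFun_combination]
    congr 1 <;> ring
  have hhess (v : E22) : hessianAt I22 (fun q => σ * a * sysL R₁ R₂ q + σ * b * sphereFun A B C q)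
      p v v = σ * hessianAt I22 (sphereFun (a * R₁ + b * A) (a * R₂ + b * B) (b * C)) p v v := by
    rw [hfun, hessianAt_sphereFun, hessianAt_sphereFun]
    simp only [quadFun]
    ring
  have hpos : ∀ v ∈ orbitOrth (prodForm R₁ R₂) (sysL R₁ R₂) (sphereFun A B C) p,
      v ∉ orbitSpace (prodForm R₁ R₂) (sysL R₁ R₂) (sphereFun A B C) p →
      0 < hessianAt I22 (fun q => σ * a * sysL R₁ R₂ q + σ * b * sphereFun A B C q) p v v := by
    intro v hv hv'
    have hX := frame_hamVF_sysL hR₁ hR₂ p _ rfl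
    have hdL : prodForm R₁ R₂ p (hamVF (prodForm R₁ R₂) (sysL R₁ R₂) p) v = 0 :=
      hv _ (Submodule.subset_span (by simp))
    have hdL' : mvfderiv I22 (sysL R₁ R₂) p v = 0 := by
      have := (prodForm_hamVF hR₁ hR₂ (sysL R₁ R₂) p v).symm.trans hdL
      linarith
    rw [sysL_eq] at hdL'
    have hdL'' := (mvfderiv_sphereFun R₁ R₂ 0 p v).symm.trans hdL'
    simp only [quadFun] at hdL''
    have hlin : R₁ * frame p.1 (Prod.fst (α := E2) (β := E2) v) 2
        + R₂ * frame p.2 (Prod.snd (α := E2) (β := E2) v) 2 = 0 := by linarith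
    rcases hdef v hlin with h | ⟨t, ⟨t0, t1, t2⟩, ⟨t3, t4, t5⟩⟩
    · exact lt_of_lt_of_eq h (hhess v).symm
    · exfalso
      apply hv'
      have hvt : v = t • hamVF (prodForm R₁ R₂) (sysL R₁ R₂) p := by
        obtain ⟨⟨x0, x1, x2⟩, ⟨x3, x4, x5⟩⟩ := hX
        set X : E22 := hamVF (prodForm R₁ R₂) (sysL R₁ R₂) p with hXdef
        have h1 : Prod.fst (α := E2) (β := E2) v = t • X.1 := by
          refine frame_ext p.1 fun i => ?_
          rw [map_smul]
          fin_cases i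
          · exact t0.trans (congrArg (t * ·) x0).symm
          · exact t1.trans (congrArg (t * ·) x1).symm
          · exact t2.trans (by simp [x2])
        have h2 : Prod.snd (α := E2) (β := E2) v = t • X.2 := by
          refine frame_ext p.2 fun i => ?_
          rw [map_smul]
          fin_cases i
          · exact t3.trans (congrArg (t * ·) x3).symm
          · exact t4.trans (congrArg (t * ·) x4).symm
          · exact t5.trans (by simp [x5])
        exact Prod.ext h1 h2
      rw [hvt]
      exact Submodule.smul_mem _ _ (Submodule.subset_span (by simp))
  refine ⟨⟨rankAt_eq_one hR₁ hR₂ hp hs, _, _, hcrit, fun v hv hv0 => ?_⟩, _, _, hcrit, hpos⟩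
  by_contra hv'
  exact (hpos v hv hv').ne' (hv0 v hv)

/-! ### Lie subalgebras generated by two commuting elements -/

section LieSpan

variable {L : Type*} [LieRing L] [LieAlgebra ℝ L]

theorem mem_lieSpan_pair_iff {X Y : L} (h : ⁅X, Y⁆ = 0) (z : L) :
    z ∈ LieSubalgebra.lieSpan ℝ L {X, Y} ↔ ∃ s t : ℝ, z = s • X + t • Y := by
  have hYX : ⁅Y, X⁆ = 0 := by rw [← lie_skew, h, neg_zero]
  constructor
  · intro hz
    induction hz using LieSubalgebra.lieSpan_induction with
    | mem x hx =>
      rcases hx with rfl | rfl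
      · exact ⟨1, 0, by simp⟩
      · exact ⟨0, 1, by simp⟩
    | zero => exact ⟨0, 0, by simp⟩
    | add x y _ _ hx hy =>
      obtain ⟨s, t, rfl⟩ := hx
      obtain ⟨s', t', rfl⟩ := hy
      exact ⟨s + s', t + t', by module⟩
    | smul a x _ hx =>
      obtain ⟨s, t, rfl⟩ := hx
      exact ⟨a * s, a * t, by module⟩
    | lie x y _ _ hx hy =>
      obtain ⟨s, t, rfl⟩ := hx
      obtain ⟨s', t', rfl⟩ := hy
      exact ⟨0, 0, by simp [h, hYX]⟩
  · rintro ⟨s, t, rfl⟩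
    exact add_mem (SMulMemClass.smul_mem _ (LieSubalgebra.subset_lieSpan (by simp)))
      (SMulMemClass.smul_mem _ (LieSubalgebra.subset_lieSpan (by simp)))

theorem lie_eq_zero_of_mem_lieSpan_pair {X Y : L} (h : ⁅X, Y⁆ = 0) {z w : L}
    (hz : z ∈ LieSubalgebra.lieSpan ℝ L {X, Y}) (hw : w ∈ LieSubalgebra.lieSpan ℝ L {X, Y}) :
    ⁅z, w⁆ = 0 := by
  have hYX : ⁅Y, X⁆ = 0 := by rw [← lie_skew, h, neg_zero]
  obtain ⟨s, t, rfl⟩ := (mem_lieSpan_pair_iff h z).1 hz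
  obtain ⟨s', t', rfl⟩ := (mem_lieSpan_pair_iff h w).1 hw
  simp [h, hYX]

/-- The span of a commuting pair is abelian, hence nilpotent; `hn` is exactly self-normalization. -/
theorem isCartanSubalgebra_lieSpan_pair {X Y : L} (h : ⁅X, Y⁆ = 0)
    (hn : ∀ (D : L) (s t s' t' : ℝ), ⁅D, X⁆ = s • X + t • Y → ⁅D, Y⁆ = s' • X + t' • Y →
      ∃ a b : ℝ, D = a • X + b • Y) :
    (LieSubalgebra.lieSpan ℝ L {X, Y}).IsCartanSubalgebra where
  nilpotent := by
    have : IsLieAbelian (LieSubalgebra.lieSpan ℝ L {X, Y}) :=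
      ⟨fun z w => Subtype.ext (lie_eq_zero_of_mem_lieSpan_pair h z.2 w.2)⟩
    infer_instance
  self_normalizing := by
    refine le_antisymm (fun D hD => ?_) (LieSubalgebra.le_normalizer _)
    rw [LieSubalgebra.mem_normalizer_iff] at hD
    obtain ⟨s, t, h1⟩ := (mem_lieSpan_pair_iff h _).1
      (hD X (LieSubalgebra.subset_lieSpan (by simp)))
    obtain ⟨s', t', h2⟩ := (mem_lieSpan_pair_iff h _).1
      (hD Y (LieSubalgebra.subset_lieSpan (by simp)))
    exact (mem_lieSpan_pair_iff h D).2 (hn D s t s' t' h1 h2)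

/-- Here `D` normalizes the span without commuting with `Y`, so it cannot belong to this abelian
algebra. -/
theorem not_isCartanSubalgebra_lieSpan_pair {X Y : L} (h : ⁅X, Y⁆ = 0) (D : L) (k l : ℝ)
    (h₁ : ⁅D, X⁆ = 0) (h₂ : ⁅D, Y⁆ = k • X + l • Y) (h₃ : ⁅D, Y⁆ ≠ 0) :
    ¬ (LieSubalgebra.lieSpan ℝ L {X, Y}).IsCartanSubalgebra := by
  intro hc
  have hD : D ∈ LieSubalgebra.lieSpan ℝ L {X, Y} := by
    rw [← hc.self_normalizing, LieSubalgebra.mem_normalizer_iff]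
    intro y hy
    obtain ⟨s, t, rfl⟩ := (mem_lieSpan_pair_iff h y).1 hy
    refine (mem_lieSpan_pair_iff h _).2 ⟨t * k, t * l, ?_⟩
    rw [lie_add, lie_smul, lie_smul, h₁, h₂]
    module
  exact h₃ (lie_eq_zero_of_mem_lieSpan_pair h hD (LieSubalgebra.subset_lieSpan (by simp)))

end LieSpan

/-! ### Pairs of commuting infinitesimally symplectic matrices -/

/-- The matrix of the linearization of the Hamiltonian vector field at a product of poles. -/
def linMatrix (a b c d : ℝ) : Matrix (Fin 4) (Fin 4) ℝ :=
  !![0, -a, 0, -b; a, 0, b, 0; 0, -c, 0, -d; c, 0, d, 0]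

theorem linMatrix_combination (s t a b c d a' b' c' d' : ℝ) :
    s • linMatrix a b c d + t • linMatrix a' b' c' d'
      = linMatrix (s * a + t * a') (s * b + t * b') (s * c + t * c') (s * d + t * d') := by
  ext i j
  fin_cases i <;> fin_cases j <;> simp [linMatrix] <;> ring

theorem linMatrix_commute (a b c d : ℝ) :
    linMatrix 1 0 0 1 * linMatrix a b c d = linMatrix a b c d * linMatrix 1 0 0 1 := by
  ext i j
  fin_cases i <;> fin_cases j <;> simp [linMatrix, Matrix.mul_apply, Fin.sum_univ_four]

theorem trace_linMatrix_mul (a b c d a' b' c' d' : ℝ) :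
    (linMatrix a b c d * linMatrix a' b' c' d').trace
      = -2 * (a * a' + b * c' + c * b' + d * d') := by
  simp [linMatrix, Matrix.trace, Fin.sum_univ_four]
  ring

/-- On `ℂ²` the matrix is `i M` with `M = !![a, b; c, d]`. Its real eigenvalue polynomial is `(X² +
λ₁²)(X² + λ₂²)`, where `λ₁`, `λ₂` are the eigenvalues of `M`. -/
theorem charpoly_linMatrix (a b c d : ℝ) : (linMatrix a b c d).charpoly
    = X ^ 4 + C ((a + d) ^ 2 - 2 * (a * d - b * c)) * X ^ 2 + C ((a * d - b * c) ^ 2) := by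
  simp [linMatrix, Matrix.charpoly, Matrix.charmatrix, Matrix.det_succ_row_zero,
    Fin.sum_univ_succ, Fin.succAbove]
  rw [show (C 2 : ℝ[X]) = 2 from map_ofNat C 2]
  ring

theorem trace_bracket_mul_eq_zero {n : Type*} [Fintype n] (D X Y : Matrix n n ℝ)
    (h : X * Y = Y * X) : ((D * X - X * D) * Y).trace = 0 := by
  rw [sub_mul, Matrix.trace_sub, sub_eq_zero, Matrix.mul_assoc, h, ← Matrix.mul_assoc,
    Matrix.trace_mul_comm, ← Matrix.mul_assoc]

/-- A bracket `[D, Z]` is trace-orthogonal to everything commuting with `Z`. On the span of the pair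
the Gram determinant of the trace form is `4 ((α - β)² + 4 γ δ)`, so a bracket lying in the span
vanishes. -/
theorem bracket_eq_zero_of_mem_span {α β γ δ s t : ℝ} (hd : (α - β) ^ 2 + 4 * γ * δ ≠ 0)
    {D Z : Matrix (Fin 4) (Fin 4) ℝ} (hZ₁ : linMatrix 1 0 0 1 * Z = Z * linMatrix 1 0 0 1)
    (hZ₂ : linMatrix α γ δ β * Z = Z * linMatrix α γ δ β)
    (h : D * Z - Z * D = s • linMatrix 1 0 0 1 + t • linMatrix α γ δ β) :
    D * Z = Z * D := by
  have h1 := trace_bracket_mul_eq_zero D Z (linMatrix 1 0 0 1) hZ₁.symm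
  have h2 := trace_bracket_mul_eq_zero D Z (linMatrix α γ δ β) hZ₂.symm
  rw [h, linMatrix_combination, trace_linMatrix_mul] at h1 h2
  have ht : t * ((α - β) ^ 2 + 4 * γ * δ) = 0 := by
    linear_combination -h2 + (α + β) / 2 * h1
  have ht0 := (mul_eq_zero.1 ht).resolve_right hd
  subst ht0
  have hs : s = 0 := by linear_combination -h1 / 4
  subst hs
  rw [← sub_eq_zero, h]
  simp

/-- The infinitesimally symplectic matrices commuting with a regular pair are its
combinations. -/
theorem exists_combination_of_commute {α β γ δ g h : ℝ} (hg : g ≠ 0) (hh : h ≠ 0)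
    (hs : g * γ = h * δ) (hd : (α - β) ^ 2 + 4 * γ * δ ≠ 0) {D : Matrix (Fin 4) (Fin 4) ℝ}
    (h₁ : D * linMatrix 1 0 0 1 = linMatrix 1 0 0 1 * D)
    (h₂ : D * linMatrix α γ δ β = linMatrix α γ δ β * D)
    (s₁ : D 0 0 = -D 1 1) (s₂ : D 2 2 = -D 3 3) (s₃ : h * D 3 0 = g * D 1 2)
    (s₄ : -h * D 2 0 = g * D 1 3) :
    ∃ s t : ℝ, D = s • linMatrix 1 0 0 1 + t • linMatrix α γ δ β := by
  have e (i j : Fin 4) := congrFun (congrFun h₁ i) j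
  have f (i j : Fin 4) := congrFun (congrFun h₂ i) j
  simp only [Matrix.mul_apply, Fin.sum_univ_four] at e f
  have e00 := e 0 0
  have e01 := e 0 1
  have e02 := e 0 2
  have e03 := e 0 3
  have e20 := e 2 0
  have e21 := e 2 1
  have e22 := e 2 2
  have e23 := e 2 3
  have f00 := f 0 0
  have f01 := f 0 1
  have f02 := f 0 2
  have f03 := f 0 3
  have f20 := f 2 0
  have f21 := f 2 1
  have f23 := f 2 3
  simp [linMatrix] at e00 e01 e02 e03 e20 e21 e22 e23 f00 f01 f02 f03 f20 f21 f23
  have d00 : D 0 0 = 0 := by linarith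
  have d11 : D 1 1 = 0 := by linarith
  have d22 : D 2 2 = 0 := by linarith
  have d33 : D 3 3 = 0 := by linarith
  have hδ : γ = 0 → δ = 0 := by
    rintro rfl
    rw [mul_zero, zero_eq_mul] at hs
    exact hs.resolve_left hh
  have d13 : D 1 3 = 0 := by
    by_cases hγ : γ = 0
    · have hδ0 := hδ hγ
      subst hγ hδ0
      have hαβ : α - β ≠ 0 := by
        intro h0
        simp [h0] at hd
      refine (mul_eq_zero.1 ?_).resolve_left hαβ
      linear_combination f03 + β * e03
    -- Commutation relates `D 1 3` and `D 2 0` through `γ`, `δ`; the symplectic relations `hs` and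
    -- `s₄` relate them with the opposite sign.
    · have : 2 * g * γ * D 1 3 = 0 := by
        grind
      simpa [hg, hγ] using this
  have d20 : D 2 0 = 0 := by
    rw [d13, mul_zero, mul_eq_zero] at s₄
    exact s₄.resolve_left (neg_ne_zero.2 hh)
  have d02 : D 0 2 = 0 := by linarith
  have d31 : D 3 1 = 0 := by linarith
  have fin (s t : ℝ) (k1 : D 1 0 = s + t * α) (k2 : D 3 2 = s + t * β) (k3 : D 1 2 = t * γ)
      (k4 : D 3 0 = t * δ) : D = s • linMatrix 1 0 0 1 + t • linMatrix α γ δ β := by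
    rw [linMatrix_combination]
    ext i j
    fin_cases i <;> fin_cases j <;> simp [linMatrix] <;> linarith
  by_cases hγ : γ = 0
  · have hδ0 := hδ hγ
    subst hγ hδ0
    have hαβ : α - β ≠ 0 := by
      intro h0
      simp [h0] at hd
    have d12 : D 1 2 = 0 := by
      refine (mul_eq_zero.1 ?_).resolve_left hαβ
      linear_combination f02 - β * e02
    have d30 : D 3 0 = 0 := by
      rw [d12, mul_zero, mul_eq_zero] at s₃
      exact s₃.resolve_left hh
    refine ⟨D 1 0 - (D 1 0 - D 3 2) / (α - β) * α, (D 1 0 - D 3 2) / (α - β), ?_⟩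
    apply fin
    · ring
    · field_simp
      ring
    · rw [d12, mul_zero]
    · rw [d30, mul_zero]
  · refine ⟨D 1 0 - D 1 2 / γ * α, D 1 2 / γ, ?_⟩
    apply fin
    · ring
    · field_simp
      linear_combination f02 - γ * e00 - β * e02
    · field_simp
    · rw [div_mul_eq_mul_div, eq_div_iff hγ]
      refine mul_left_cancel₀ hh ?_
      linear_combination γ * s₃ + D 1 2 * hs

/-! ### Linearizations at the products of poles -/

/-- The horizontal coordinates of a tangent vector at a product of poles. -/
def poleCoord (p : S2 × S2) : E22 →ₗ[ℝ] (Fin 4 → ℝ) where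
  toFun v := ![frame p.1 v.1 0, frame p.1 v.1 1, frame p.2 v.2 0, frame p.2 v.2 1]
  map_add' u v := by
    ext i
    fin_cases i <;> simp
  map_smul' c v := by
    ext i
    fin_cases i <;> simp

theorem poleCoord_injective {p : S2 × S2} (h₁ : IsPole p.1) (h₂ : IsPole p.2) :
    Function.Injective (poleCoord p) := by
  intro u v h
  have h' (i : Fin 4) := congrFun h i
  refine Prod.ext (frame_ext p.1 fun i => ?_) (frame_ext p.2 fun i => ?_)
  · fin_cases i
    · exact h' 0
    · exact h' 1
    · exact (h₁.frame_eq_zero _).trans (h₁.frame_eq_zero _).symm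
  · fin_cases i
    · exact h' 2
    · exact h' 3
    · exact (h₂.frame_eq_zero _).trans (h₂.frame_eq_zero _).symm

/-- The basis of the tangent space at a product of poles associated with `poleCoord`. -/
def poleBasis {p : S2 × S2} (h₁ : IsPole p.1) (h₂ : IsPole p.2) :
    Module.Basis (Fin 4) ℝ E22 :=
  Module.Basis.ofEquivFun (LinearEquiv.ofInjectiveOfFinrankEq (poleCoord p)
    (poleCoord_injective h₁ h₂) (by simp))

/-- The matrix of an endomorphism of the tangent space at a product of poles. -/
def poleMatrix {p : S2 × S2} (h₁ : IsPole p.1) (h₂ : IsPole p.2) :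
    Module.End ℝ (TangentSpace I22 p) ≃ₐ[ℝ] Matrix (Fin 4) (Fin 4) ℝ :=
  LinearMap.toMatrixAlgEquiv (poleBasis h₁ h₂)

theorem poleCoord_poleBasis {p : S2 × S2} (h₁ : IsPole p.1) (h₂ : IsPole p.2)
    (i : Fin 4) : poleCoord p (poleBasis h₁ h₂ i) = Pi.single i 1 := by
  have h := (poleBasis h₁ h₂).equivFun_self i
  refine Eq.trans ?_ ((funext fun j => ?_ : (fun j => if i = j then (1 : ℝ) else 0) = Pi.single i 1))
  · funext j
    rw [← h j, poleBasis, Module.Basis.equivFun_ofEquivFun]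
    rfl
  · simp [Pi.single_apply, eq_comm]

theorem poleCoord_apply {p : S2 × S2} (h₁ : IsPole p.1) (h₂ : IsPole p.2)
    (D : Module.End ℝ (TangentSpace I22 p)) (v : E22) :
    poleCoord p (D v) = (poleMatrix h₁ h₂ D).mulVec (poleCoord p v) := by
  have h := LinearMap.toMatrix_mulVec_repr (poleBasis h₁ h₂) (poleBasis h₁ h₂)
    (D : E22 →ₗ[ℝ] E22) v
  have hr (w : E22) : ((poleBasis h₁ h₂).repr w : Fin 4 → ℝ) = poleCoord p w := by
    rw [← Module.Basis.equivFun_apply, poleBasis, Module.Basis.equivFun_ofEquivFun]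
    rfl
  rw [hr, hr] at h
  exact h.symm

theorem poleMatrix_apply {p : S2 × S2} (h₁ : IsPole p.1) (h₂ : IsPole p.2)
    (D : Module.End ℝ (TangentSpace I22 p)) (i j : Fin 4) :
    poleMatrix h₁ h₂ D i j = poleCoord p (D (poleBasis h₁ h₂ j)) i := by
  rw [poleCoord_apply h₁ h₂, poleCoord_poleBasis]
  simp

theorem poleMatrix_eq_of_forall {p : S2 × S2} (h₁ : IsPole p.1) (h₂ : IsPole p.2)
    {D : Module.End ℝ (TangentSpace I22 p)}
    {M : Matrix (Fin 4) (Fin 4) ℝ} (h : ∀ v : E22, poleCoord p (D v) = M.mulVec (poleCoord p v)) :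
    poleMatrix h₁ h₂ D = M := by
  ext i j
  rw [poleMatrix_apply, h, poleCoord_poleBasis]
  simp

theorem prodForm_pole {p : S2 × S2} (h₁ : IsPole p.1) (h₂ : IsPole p.2)
    (R₁ R₂ : ℝ) (u v : E22) : prodForm R₁ R₂ p u v
    = -(R₁ * (p.1 : R3) 2 * (poleCoord p u 0 * poleCoord p v 1 - poleCoord p u 1 * poleCoord p v 0)
      + R₂ * (p.2 : R3) 2
        * (poleCoord p u 2 * poleCoord p v 3 - poleCoord p u 3 * poleCoord p v 2)) := by
  rw [prodForm_apply, detForm_coord, detForm_coord]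
  simp [poleCoord, h₁.1, h₁.2, h₂.1, h₂.2]
  ring

theorem hessianAt_pole {p : S2 × S2} (h₁ : IsPole p.1) (h₂ : IsPole p.2)
    (A B C : ℝ) (u v : E22) : hessianAt I22 (sphereFun A B C) p u v
    = C * (poleCoord p u 0 * poleCoord p v 2 + poleCoord p u 1 * poleCoord p v 3
        + poleCoord p u 2 * poleCoord p v 0 + poleCoord p u 3 * poleCoord p v 1)
      - A * (p.1 : R3) 2 * (poleCoord p u 0 * poleCoord p v 0 + poleCoord p u 1 * poleCoord p v 1)
      - B * (p.2 : R3) 2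
        * (poleCoord p u 2 * poleCoord p v 2 + poleCoord p u 3 * poleCoord p v 3) := by
  rw [hessianAt_sphereFun, frame_inner_coord p.1, frame_inner_coord p.2]
  simp [poleCoord, quadFun, h₁.1, h₁.2, h₂.1, h₂.2, h₁.frame_eq_zero, h₂.frame_eq_zero]
  ring

theorem sq_eq_one_of_isPole {q : S2} (hq : IsPole q) : (q : R3) 2 ^ 2 = 1 := by
  have h := sphere_coord q
  rw [hq.1, hq.2] at h
  linarith

/-- The entries are obtained by solving `Ω(A v, w) = -D²f(v, w)` on the four basis vectors `w`,
using `z² = 1` at a pole. -/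
theorem poleMatrix_linHam {p : S2 × S2} (h₁ : IsPole p.1) (h₂ : IsPole p.2)
    {R₁ R₂ : ℝ} (hR₁ : 0 < R₁) (hR₂ : 0 < R₂) (A B C : ℝ) :
    poleMatrix h₁ h₂ (linHam (prodForm R₁ R₂) (sphereFun A B C) p).toLinearMap
      = linMatrix (A / R₁) (-C * (p.1 : R3) 2 / R₁) (-C * (p.2 : R3) 2 / R₂) (B / R₂) := by
  refine poleMatrix_eq_of_forall h₁ h₂ fun v => ?_
  have hs1 := sq_eq_one_of_isPole h₁
  have hs2 := sq_eq_one_of_isPole h₂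
  set Av : E22 := linHam (prodForm R₁ R₂) (sphereFun A B C) p v with hA
  have h (w : E22) : prodForm R₁ R₂ p Av w = -hessianAt I22 (sphereFun A B C) p v w :=
    prodForm_linHam hR₁ hR₂ _ p v w
  have hb (i : Fin 4) := h (poleBasis h₁ h₂ i)
  simp only [prodForm_pole h₁ h₂, hessianAt_pole h₁ h₂, poleCoord_poleBasis] at hb
  have hb0 := hb 0
  have hb1 := hb 1
  have hb2 := hb 2
  have hb3 := hb 3
  simp at hb0 hb1 hb2 hb3
  change poleCoord p Av = _
  ext i
  fin_cases i <;> simp [linMatrix, Matrix.mulVec, dotProduct, Fin.sum_univ_four] <;> field_simp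
  · linear_combination (-(p.1 : R3) 2) * hb1
      + (-A * poleCoord p v 1 - R₁ * poleCoord p Av 0) * hs1
  · linear_combination (p.1 : R3) 2 * hb0
      + (A * poleCoord p v 0 - R₁ * poleCoord p Av 1) * hs1
  · linear_combination (-(p.2 : R3) 2) * hb3
      + (-B * poleCoord p v 3 - R₂ * poleCoord p Av 2) * hs2
  · linear_combination (p.2 : R3) 2 * hb2
      + (B * poleCoord p v 2 - R₂ * poleCoord p Av 3) * hs2

theorem mem_spAt_iff (R₁ R₂ : ℝ) {p : S2 × S2} (D : Module.End ℝ (TangentSpace I22 p)) :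
    D ∈ spAt (prodForm R₁ R₂) p ↔
      ∀ u v : E22, prodForm R₁ R₂ p (D u) v = -prodForm R₁ R₂ p u (D v) :=
  Iff.rfl

theorem linHam_mem_spAt {R₁ R₂ : ℝ} (hR₁ : 0 < R₁) (hR₂ : 0 < R₂) (A B C : ℝ) (p : S2 × S2) :
    (linHam (prodForm R₁ R₂) (sphereFun A B C) p).toLinearMap ∈ spAt (prodForm R₁ R₂) p := by
  rw [mem_spAt_iff]
  intro u v
  have h1 := prodForm_linHam hR₁ hR₂ (sphereFun A B C) p u v
  have h2 := prodForm_linHam hR₁ hR₂ (sphereFun A B C) p v u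
  have h3 : hessianAt I22 (sphereFun A B C) p u v = hessianAt I22 (sphereFun A B C) p v u := by
    rw [hessianAt_sphereFun, hessianAt_sphereFun, real_inner_comm, real_inner_comm u.2]
    ring
  refine h1.trans ?_
  rw [h3, ← h2]
  exact prodForm_antisymm R₁ R₂ p _ _

/-- The element of the symplectic Lie algebra given by the linearization at `p`. -/
def linElement {R₁ R₂ : ℝ} (hR₁ : 0 < R₁) (hR₂ : 0 < R₂) (A B C : ℝ) (p : S2 × S2) :
    spAt (prodForm R₁ R₂) p :=
  ⟨_, linHam_mem_spAt hR₁ hR₂ A B C p⟩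

theorem linAlgebra_eq {R₁ R₂ : ℝ} (hR₁ : 0 < R₁) (hR₂ : 0 < R₂) (A B C : ℝ) (p : S2 × S2) :
    linAlgebra (prodForm R₁ R₂) (sysL R₁ R₂) (sphereFun A B C) p
      = LieSubalgebra.lieSpan ℝ (spAt (prodForm R₁ R₂) p)
        {linElement hR₁ hR₂ R₁ R₂ 0 p, linElement hR₁ hR₂ A B C p} := by
  unfold linAlgebra
  rw [sysL_eq]
  congr 1
  ext D
  simp only [mem_ofPred_eq, mem_insert_iff, mem_singleton_iff, linElement, Subtype.ext_iff]

theorem poleMatrix_bracket {R₁ R₂ : ℝ} {p : S2 × S2} (h₁ : IsPole p.1) (h₂ : IsPole p.2)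
    (D D' : spAt (prodForm R₁ R₂) p) :
    poleMatrix h₁ h₂ (⁅D, D'⁆ : spAt (prodForm R₁ R₂) p)
      = poleMatrix h₁ h₂ D * poleMatrix h₁ h₂ D' - poleMatrix h₁ h₂ D' * poleMatrix h₁ h₂ D := by
  rw [LieSubalgebra.coe_bracket, LieRing.of_associative_ring_bracket, map_sub, map_mul, map_mul]

theorem poleMatrix_combination {R₁ R₂ : ℝ} {p : S2 × S2} (h₁ : IsPole p.1) (h₂ : IsPole p.2)
    (s t : ℝ) (D D' : spAt (prodForm R₁ R₂) p) :
    poleMatrix h₁ h₂ (s • D + t • D' : spAt (prodForm R₁ R₂) p)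
      = s • poleMatrix h₁ h₂ D + t • poleMatrix h₁ h₂ D' := by
  have h : ((s • D + t • D' : spAt (prodForm R₁ R₂) p) : Module.End ℝ (TangentSpace I22 p))
    = s • (D : Module.End ℝ (TangentSpace I22 p)) + t • (D' : Module.End ℝ (TangentSpace I22 p)) :=
    rfl
  rw [h]
  exact (map_add (poleMatrix h₁ h₂) _ _).trans
    (congrArg₂ (· + ·) (map_smul (poleMatrix h₁ h₂) _ _) (map_smul (poleMatrix h₁ h₂) _ _))

theorem poleMatrix_injective {R₁ R₂ : ℝ} {p : S2 × S2} (h₁ : IsPole p.1) (h₂ : IsPole p.2)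
    {D D' : spAt (prodForm R₁ R₂) p}
    (h : poleMatrix h₁ h₂ D = poleMatrix h₁ h₂ D') : D = D' :=
  Subtype.ext ((poleMatrix h₁ h₂).injective h)

theorem poleMatrix_linElement {R₁ R₂ : ℝ} (hR₁ : 0 < R₁) (hR₂ : 0 < R₂) (A B C : ℝ)
    {p : S2 × S2} (h₁ : IsPole p.1) (h₂ : IsPole p.2) :
    poleMatrix h₁ h₂ (linElement hR₁ hR₂ A B C p)
      = linMatrix (A / R₁) (-C * (p.1 : R3) 2 / R₁) (-C * (p.2 : R3) 2 / R₂) (B / R₂) :=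
  poleMatrix_linHam h₁ h₂ hR₁ hR₂ A B C

theorem poleMatrix_linElement_sysL {R₁ R₂ : ℝ} (hR₁ : 0 < R₁) (hR₂ : 0 < R₂)
    {p : S2 × S2} (h₁ : IsPole p.1) (h₂ : IsPole p.2) :
    poleMatrix h₁ h₂ (linElement hR₁ hR₂ R₁ R₂ 0 p) = linMatrix 1 0 0 1 := by
  rw [poleMatrix_linElement]
  simp [hR₁.ne', hR₂.ne']

theorem linElement_bracket {R₁ R₂ : ℝ} (hR₁ : 0 < R₁) (hR₂ : 0 < R₂) (A B C : ℝ)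
    {p : S2 × S2} (h₁ : IsPole p.1) (h₂ : IsPole p.2) :
    ⁅linElement hR₁ hR₂ R₁ R₂ 0 p, linElement hR₁ hR₂ A B C p⁆ = 0 := by
  apply poleMatrix_injective h₁ h₂
  rw [poleMatrix_bracket, poleMatrix_linElement_sysL, poleMatrix_linElement, linMatrix_commute,
    sub_self]
  exact (map_zero (poleMatrix h₁ h₂)).symm

/-- The discriminant of the matrix governing the linearizations at a product of poles. -/
def poleDisc (R₁ R₂ A B C : ℝ) (p : S2 × S2) : ℝ :=
  (A / R₁ - B / R₂) ^ 2 + 4 * (-C * (p.1 : R3) 2 / R₁) * (-C * (p.2 : R3) 2 / R₂)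

theorem poleDisc_eq {R₁ R₂ : ℝ} (hR₁ : 0 < R₁) (hR₂ : 0 < R₂) (A B C : ℝ) (p : S2 × S2) :
    poleDisc R₁ R₂ A B C p * (R₁ * R₂) ^ 2 = (R₂ * A - R₁ * B) ^ 2
      + 4 * (R₁ * R₂) * C ^ 2 * ((p.1 : R3) 2 * (p.2 : R3) 2) := by
  unfold poleDisc
  field_simp

theorem IsPole.sq_eq_one {q : S2} (hq : IsPole q) : (q : R3) 2 ^ 2 = 1 := sq_eq_one_of_isPole hq

theorem IsPole.ne_zero {q : S2} (hq : IsPole q) : (q : R3) 2 ≠ 0 := by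
  intro h
  have := sq_eq_one_of_isPole hq
  rw [h] at this
  norm_num at this

/-- A normalizing element commutes with both generators by the trace argument, and then is one of
their combinations. -/
theorem isNondegRankZero_of_poleDisc {R₁ R₂ : ℝ} (hR₁ : 0 < R₁) (hR₂ : 0 < R₂) (A B C : ℝ)
    {p : S2 × S2} (h₁ : IsPole p.1) (h₂ : IsPole p.2) (hd : poleDisc R₁ R₂ A B C p ≠ 0) :
    IsNondegRankZero (prodForm R₁ R₂) (sysL R₁ R₂) (sphereFun A B C) p := by
  refine ⟨rankAt_of_isPole R₁ R₂ A B C h₁ h₂, ?_⟩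
  rw [linAlgebra_eq hR₁ hR₂]
  refine isCartanSubalgebra_lieSpan_pair (linElement_bracket hR₁ hR₂ A B C h₁ h₂)
    fun D s t s' t' hD hD' => ?_
  have e1 := congrArg (fun z : spAt (prodForm R₁ R₂) p => poleMatrix h₁ h₂ z) hD
  have e2 := congrArg (fun z : spAt (prodForm R₁ R₂) p => poleMatrix h₁ h₂ z) hD'
  simp only [poleMatrix_bracket, poleMatrix_combination, poleMatrix_linElement_sysL,
    poleMatrix_linElement hR₁ hR₂ A B C] at e1 e2
  have c1 := bracket_eq_zero_of_mem_span hd rfl (linMatrix_commute _ _ _ _).symm e1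
  have c2 := bracket_eq_zero_of_mem_span hd (linMatrix_commute _ _ _ _) rfl e2
  have hsk := (mem_spAt_iff R₁ R₂ (D : Module.End ℝ (TangentSpace I22 p))).1 D.2
  have hb (i j : Fin 4) := hsk (poleBasis h₁ h₂ i) (poleBasis h₁ h₂ j)
  have hb' (i j : Fin 4) := ((prodForm_pole h₁ h₂ R₁ R₂ _ _).symm.trans (hb i j)).trans
    (congrArg Neg.neg (prodForm_pole h₁ h₂ R₁ R₂ _ _))
  -- Skew-adjointness on pairs of basis vectors gives the entry relations required of `D`.
  simp only [← poleMatrix_apply h₁ h₂, poleCoord_poleBasis] at hb'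
  have s1 := hb' 0 1
  have s2 := hb' 2 3
  have s3 := hb' 0 2
  have s4 := hb' 0 3
  simp at s1 s2 s3 s4
  have hg : R₁ * (p.1 : R3) 2 ≠ 0 := mul_ne_zero hR₁.ne' h₁.ne_zero
  have hh : R₂ * (p.2 : R3) 2 ≠ 0 := mul_ne_zero hR₂.ne' h₂.ne_zero
  obtain ⟨a, b, hab⟩ := exists_combination_of_commute hg hh (by
      have q1 := h₁.sq_eq_one
      have q2 := h₂.sq_eq_one
      field_simp
      rw [q1, q2]
      ring) hd c1 c2
      (mul_left_cancel₀ hg (by linear_combination -s1))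
      (mul_left_cancel₀ hh (by linear_combination -s2)) (by linear_combination s3)
      (by linear_combination s4)
  refine ⟨a, b, poleMatrix_injective h₁ h₂ ?_⟩
  rw [poleMatrix_combination, poleMatrix_linElement_sysL, poleMatrix_linElement, hab]

/-- An infinitesimally symplectic matrix normalizing the algebra of a degenerate pair. -/
def normMatrix (g h : ℝ) : Matrix (Fin 4) (Fin 4) ℝ :=
  !![0, 0, h, 0; 0, 0, 0, h; -g, 0, 0, 0; 0, -g, 0, 0]

theorem normMatrix_bracket (g h α β γ δ : ℝ) :
    normMatrix g h * linMatrix α γ δ β - linMatrix α γ δ β * normMatrix g h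
      = linMatrix (h * δ + g * γ) (h * (β - α)) (g * (β - α)) (-(g * γ + h * δ)) := by
  ext i j
  fin_cases i <;> fin_cases j <;> simp [normMatrix, linMatrix] <;> ring

/-- With zero discriminant, `M - (α + β)/2` is nilpotent; the bracket is `-(h (α - β) / γ)` times
it. -/
theorem normMatrix_bracket_eq {g h α β γ δ : ℝ} (hγ : γ ≠ 0) (hs : g * γ = h * δ)
    (hd : (α - β) ^ 2 + 4 * γ * δ = 0) :
    normMatrix g h * linMatrix α γ δ β - linMatrix α γ δ β * normMatrix g h
      = (h * (α - β) / γ * ((α + β) / 2)) • linMatrix 1 0 0 1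
        + (-(h * (α - β) / γ)) • linMatrix α γ δ β := by
  have k1 : h * δ + g * γ = -(h * (α - β) ^ 2 / (2 * γ)) := by
    field_simp
    linear_combination 2 * γ * hs + h * hd
  rw [linMatrix_combination, normMatrix_bracket]
  congr 1
  · rw [k1]
    field_simp
    ring
  · field_simp
    ring
  · field_simp
    linear_combination 2 * (β - α) * hs
  · rw [add_comm, k1]
    field_simp
    ring

theorem exists_poleMatrix_eq_normMatrix {p : S2 × S2} (h₁ : IsPole p.1) (h₂ : IsPole p.2)
    (R₁ R₂ : ℝ) : ∃ D : spAt (prodForm R₁ R₂) p,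
      poleMatrix h₁ h₂ D = normMatrix (R₁ * (p.1 : R3) 2) (R₂ * (p.2 : R3) 2) := by
  refine ⟨⟨(poleMatrix h₁ h₂).symm (normMatrix (R₁ * (p.1 : R3) 2) (R₂ * (p.2 : R3) 2)), ?_⟩,
    AlgEquiv.apply_symm_apply _ _⟩
  rw [mem_spAt_iff]
  intro u v
  refine (prodForm_pole h₁ h₂ R₁ R₂ _ _).trans (Eq.trans ?_
    (congrArg Neg.neg (prodForm_pole h₁ h₂ R₁ R₂ _ _)).symm)
  rw [poleCoord_apply h₁ h₂, poleCoord_apply h₁ h₂, AlgEquiv.apply_symm_apply]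
  simp [normMatrix, Matrix.mulVec, dotProduct, Fin.sum_univ_four]
  ring

theorem bracket_sysL_eq_zero {R₁ R₂ : ℝ} (hR₁ : 0 < R₁) (hR₂ : 0 < R₂) {g h : ℝ}
    {p : S2 × S2} (h₁ : IsPole p.1) (h₂ : IsPole p.2) {D : spAt (prodForm R₁ R₂) p}
    (hD : poleMatrix h₁ h₂ D = normMatrix g h) :
    ⁅D, linElement hR₁ hR₂ R₁ R₂ 0 p⁆ = 0 := by
  apply poleMatrix_injective h₁ h₂
  rw [poleMatrix_bracket, poleMatrix_linElement_sysL, hD, normMatrix_bracket]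
  refine Eq.trans ?_ (map_zero (poleMatrix h₁ h₂)).symm
  ext i j
  fin_cases i <;> fin_cases j <;> simp [linMatrix]

theorem bracket_eq_combination {R₁ R₂ : ℝ} {p : S2 × S2} (h₁ : IsPole p.1) (h₂ : IsPole p.2)
    {D X Y : spAt (prodForm R₁ R₂) p} {k l : ℝ}
    (h : poleMatrix h₁ h₂ D * poleMatrix h₁ h₂ Y - poleMatrix h₁ h₂ Y * poleMatrix h₁ h₂ D
      = k • poleMatrix h₁ h₂ X + l • poleMatrix h₁ h₂ Y) : ⁅D, Y⁆ = k • X + l • Y :=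
  poleMatrix_injective h₁ h₂ ((poleMatrix_bracket h₁ h₂ D Y).trans
    (h.trans (poleMatrix_combination h₁ h₂ k l X Y).symm))

theorem not_isNondegRankZero_of_poleDisc {R₁ R₂ : ℝ} (hR₁ : 0 < R₁) (hR₂ : 0 < R₂) (A B C : ℝ)
    {p : S2 × S2} (h₁ : IsPole p.1) (h₂ : IsPole p.2) (hd : poleDisc R₁ R₂ A B C p = 0)
    (hC : C ≠ 0) : ¬ IsNondegRankZero (prodForm R₁ R₂) (sysL R₁ R₂) (sphereFun A B C) p := by
  rintro ⟨-, hcartan⟩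
  rw [linAlgebra_eq hR₁ hR₂] at hcartan
  have hg0 : R₁ * (p.1 : R3) 2 ≠ 0 := mul_ne_zero hR₁.ne' h₁.ne_zero
  obtain ⟨D, hD⟩ := exists_poleMatrix_eq_normMatrix h₁ h₂ R₁ R₂
  have hγ0 : -C * (p.1 : R3) 2 / R₁ ≠ 0 :=
    div_ne_zero (mul_ne_zero (neg_ne_zero.2 hC) h₁.ne_zero) hR₁.ne'
  have hs : R₁ * (p.1 : R3) 2 * (-C * (p.1 : R3) 2 / R₁)
      = R₂ * (p.2 : R3) 2 * (-C * (p.2 : R3) 2 / R₂) := by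
    have q1 := h₁.sq_eq_one
    have q2 := h₂.sq_eq_one
    field_simp
    rw [q1, q2]
  have hX := poleMatrix_linElement_sysL hR₁ hR₂ h₁ h₂
  have hY := poleMatrix_linElement hR₁ hR₂ A B C h₁ h₂
  have m := normMatrix_bracket_eq hγ0 hs hd
  have m' := normMatrix_bracket (R₁ * (p.1 : R3) 2) (R₂ * (p.2 : R3) 2) (A / R₁) (B / R₂)
    (-C * (p.1 : R3) 2 / R₁) (-C * (p.2 : R3) 2 / R₂)
  refine not_isCartanSubalgebra_lieSpan_pair (linElement_bracket hR₁ hR₂ A B C h₁ h₂) D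
    _ _ (bracket_sysL_eq_zero hR₁ hR₂ h₁ h₂ hD)
    (bracket_eq_combination h₁ h₂ (by rw [hX, hY, hD]; exact m)) (fun h0 => ?_) hcartan
  have q := (poleMatrix_bracket h₁ h₂ D (linElement hR₁ hR₂ A B C p)).symm
  rw [h0, hD, hY, m'] at q
  -- The entry `(1, 0)` of the bracket is `g γ + h δ = 2 g γ`, which is not zero.
  have e := congrFun (congrFun (q.trans (map_zero (poleMatrix h₁ h₂))) 1) 0
  have : 2 * (R₁ * (p.1 : R3) 2 * (-C * (p.1 : R3) 2 / R₁)) = 0 := by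
    simp only [linMatrix, Matrix.of_apply, Matrix.cons_val_one, Matrix.cons_val_zero,
      Matrix.zero_apply] at e
    linarith
  rcases mul_eq_zero.1 ((mul_eq_zero.1 this).resolve_left two_ne_zero) with h | h
  · exact hg0 h
  · exact hγ0 h

/-! ### Types of the singularities of rank zero -/

/-- Here `τ` and `Δ` are the trace and determinant of `a + b M`. Adding multiples of `L` moves `τ`
freely without changing the discriminant. -/
theorem linCharpoly_pole {R₁ R₂ : ℝ} (hR₁ : 0 < R₁) (hR₂ : 0 < R₂) (A B C' : ℝ)
    {p : S2 × S2} (h₁ : IsPole p.1) (h₂ : IsPole p.2) (a b : ℝ) :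
    ∃ τ Δ : ℝ, τ = 2 * a + b * (A / R₁ + B / R₂) ∧
      τ ^ 2 - 4 * Δ = b ^ 2 * poleDisc R₁ R₂ A B C' p ∧
      linCharpoly (prodForm R₁ R₂) (sysL R₁ R₂) (sphereFun A B C') p a b
        = X ^ 4 + C (τ ^ 2 - 2 * Δ) * X ^ 2 + C (Δ ^ 2) := by
  have hfun : (fun q => a * sysL R₁ R₂ q + b * sphereFun A B C' q)
      = sphereFun (a * R₁ + b * A) (a * R₂ + b * B) (b * C') := by
    rw [sysL_eq, sphereFun_combination]
    congr 1
    ring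
  have hM := poleMatrix_linHam h₁ h₂ hR₁ hR₂ (a * R₁ + b * A) (a * R₂ + b * B) (b * C')
  have hch : linCharpoly (prodForm R₁ R₂) (sysL R₁ R₂) (sphereFun A B C') p a b
      = (poleMatrix h₁ h₂ (linHam (prodForm R₁ R₂)
        (sphereFun (a * R₁ + b * A) (a * R₂ + b * B) (b * C')) p).toLinearMap).charpoly := by
    unfold linCharpoly
    rw [hfun]
    exact (LinearMap.charpoly_toMatrix (M := E22) _ (poleBasis h₁ h₂)).symm
  rw [hM, charpoly_linMatrix] at hch
  refine ⟨_, _, ?_, ?_, hch⟩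
  · field_simp
    ring
  · unfold poleDisc
    field_simp
    ring

theorem isEllipticElliptic_of_poleDisc {R₁ R₂ : ℝ} (hR₁ : 0 < R₁) (hR₂ : 0 < R₂) (A B C' : ℝ)
    {p : S2 × S2} (h₁ : IsPole p.1) (h₂ : IsPole p.2) (hd : 0 < poleDisc R₁ R₂ A B C' p) :
    IsEllipticElliptic (prodForm R₁ R₂) (sysL R₁ R₂) (sphereFun A B C') p := by
  refine ⟨isNondegRankZero_of_poleDisc hR₁ hR₂ A B C' h₁ h₂ hd.ne', ?_⟩
  set d := √(poleDisc R₁ R₂ A B C' p) / 2 with hdef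
  have hd0 : 0 < d := by positivity
  have hd2 : 4 * d ^ 2 = poleDisc R₁ R₂ A B C' p := by
    rw [hdef, div_pow, Real.sq_sqrt hd.le]
    ring
  obtain ⟨τ, Δ, hτ, hΔ, hch⟩ :=
    linCharpoly_pole hR₁ hR₂ A B C' h₁ h₂ (2 * d - (A / R₁ + B / R₂) / 2) 1
  -- The multiple of `L` shifts the eigenvalues of `M` to `d` and `3 d`: positive and distinct.
  refine ⟨2 * d - (A / R₁ + B / R₂) / 2, 1, d, 3 * d, hd0, by linarith, ?_⟩
  have hτ' : τ = 4 * d := by linarith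
  have hΔ' : Δ = 3 * d ^ 2 := by
    rw [hτ', ← hd2] at hΔ
    linarith
  rw [hch, hτ', hΔ']
  simp only [map_sub, map_mul, map_pow, map_ofNat]
  ring

theorem isFocusFocus_of_poleDisc {R₁ R₂ : ℝ} (hR₁ : 0 < R₁) (hR₂ : 0 < R₂) (A B C' : ℝ)
    {p : S2 × S2} (h₁ : IsPole p.1) (h₂ : IsPole p.2) (hd : poleDisc R₁ R₂ A B C' p < 0) :
    IsFocusFocus (prodForm R₁ R₂) (sysL R₁ R₂) (sphereFun A B C') p := by
  refine ⟨isNondegRankZero_of_poleDisc hR₁ hR₂ A B C' h₁ h₂ hd.ne, ?_⟩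
  have hd' : 0 < -poleDisc R₁ R₂ A B C' p := by linarith
  set d := √(-poleDisc R₁ R₂ A B C' p) / 2 with hdef
  have hd0 : 0 < d := by positivity
  have hd2 : 4 * d ^ 2 = -poleDisc R₁ R₂ A B C' p := by
    rw [hdef, div_pow, Real.sq_sqrt hd'.le]
    ring
  obtain ⟨τ, Δ, hτ, hΔ, hch⟩ :=
    linCharpoly_pole hR₁ hR₂ A B C' h₁ h₂ (1 - (A / R₁ + B / R₂) / 2) 1
  -- The shifted `M` has eigenvalues `1 ± i d`, so the linearization has `± d ± i`.
  refine ⟨1 - (A / R₁ + B / R₂) / 2, 1, d, 1, hd0.ne', one_ne_zero, ?_⟩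
  have hτ' : τ = 2 := by linarith
  have hΔ' : Δ = 1 + d ^ 2 := by
    rw [hτ'] at hΔ
    linarith
  rw [hch, hτ', hΔ']
  simp only [map_sub, map_mul, map_pow, map_ofNat, map_add, map_one]
  ring

/-- Viewed as a quadratic in `X²`, the characteristic polynomial has discriminant `τ² (τ² - 4 Δ) ≥
0`, whereas the focus-focus form has `-16 (α β)² < 0`. -/
theorem not_isFocusFocus_of_poleDisc {R₁ R₂ : ℝ} (hR₁ : 0 < R₁) (hR₂ : 0 < R₂) (A B C' : ℝ)
    {p : S2 × S2} (h₁ : IsPole p.1) (h₂ : IsPole p.2) (hd : 0 ≤ poleDisc R₁ R₂ A B C' p) :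
    ¬ IsFocusFocus (prodForm R₁ R₂) (sysL R₁ R₂) (sphereFun A B C') p := by
  rintro ⟨-, a, b, α, β, hα, hβ, h⟩
  obtain ⟨τ, Δ, -, hΔ, hch⟩ := linCharpoly_pole hR₁ hR₂ A B C' h₁ h₂ a b
  rw [hch] at h
  have e0 := congrArg (Polynomial.eval 0) h
  have e1 := congrArg (Polynomial.eval 1) h
  simp at e0 e1
  have hq : (τ ^ 2 - 2 * Δ) = 2 * (β ^ 2 - α ^ 2) := by linear_combination e1 - e0
  have hlt : (τ ^ 2 - 2 * Δ) ^ 2 - 4 * Δ ^ 2 = -16 * (α * β) ^ 2 := by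
    rw [hq]
    linear_combination -4 * e0
  have hge : (τ ^ 2 - 2 * Δ) ^ 2 - 4 * Δ ^ 2 = τ ^ 2 * (b ^ 2 * poleDisc R₁ R₂ A B C' p) := by
    rw [← hΔ]
    ring
  have h3 : 0 < (α * β) ^ 2 := by positivity
  have h4 : 0 ≤ τ ^ 2 * (b ^ 2 * poleDisc R₁ R₂ A B C' p) := by positivity
  linarith

/-! ### Classification of the singular points and count of the focus-focus points. -/

theorem northPole_coord : (northPole : R3) 2 = 1 := by simp [northPole]

theorem southPole_coord : (southPole : R3) 2 = -1 := by simp [southPole]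

theorem isPole_northPole : IsPole northPole := (isPole_iff _).2 (Or.inl rfl)

theorem isPole_southPole : IsPole southPole := (isPole_iff _).2 (Or.inr rfl)

theorem not_isPole_of_rankAt {R₁ R₂ : ℝ} (hR₁ : 0 < R₁) (hR₂ : 0 < R₂) {A B C : ℝ} {p : S2 × S2}
    (h : rankAt I22 (sysL R₁ R₂) (sphereFun A B C) p = 0) : IsPole p.1 ∧ IsPole p.2 := by
  by_contra hp
  have hs : IsSingularPt I22 (sysL R₁ R₂) (sphereFun A B C) p := by
    unfold IsSingularPt
    omega
  have := rankAt_eq_one hR₁ hR₂ hp hs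
  omega

theorem poleDisc_pos_of_eq {R₁ R₂ A B C : ℝ} (hR₁ : 0 < R₁) (hR₂ : 0 < R₂)
    (hC : C = 0 → A * R₂ ≠ B * R₁) {p : S2 × S2}
    (hp : (p.1 : R3) 2 * (p.2 : R3) 2 = 1) : 0 < poleDisc R₁ R₂ A B C p := by
  have h := poleDisc_eq hR₁ hR₂ A B C p
  rw [hp] at h
  have hpos : 0 < (R₂ * A - R₁ * B) ^ 2 + 4 * (R₁ * R₂) * C ^ 2 * 1 := by
    by_cases h0 : C = 0
    · have : R₂ * A - R₁ * B ≠ 0 := by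
        intro h'
        exact hC h0 (by linarith)
      positivity
    · positivity
  rw [← h] at hpos
  exact pos_of_mul_pos_left hpos (by positivity)

/-- The discriminant at the products of opposite poles. -/
def mixedDisc (R₁ R₂ A B C : ℝ) : ℝ := (R₂ * A - R₁ * B) ^ 2 - 4 * (R₁ * R₂) * C ^ 2

theorem poleDisc_mixed {R₁ R₂ : ℝ} (hR₁ : 0 < R₁) (hR₂ : 0 < R₂) (A B C : ℝ) {p : S2 × S2}
    (hp : (p.1 : R3) 2 * (p.2 : R3) 2 = -1) :
    poleDisc R₁ R₂ A B C p = mixedDisc R₁ R₂ A B C / (R₁ * R₂) ^ 2 := by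
  rw [eq_div_iff (by positivity), poleDisc_eq hR₁ hR₂, hp, mixedDisc]
  ring

theorem pole_cases {p : S2 × S2} (h₁ : IsPole p.1) (h₂ : IsPole p.2) :
    (p.1 : R3) 2 * (p.2 : R3) 2 = 1 ∨
      ((p.1 : R3) 2 * (p.2 : R3) 2 = -1 ∧ (p = (northPole, southPole) ∨ p = (southPole, northPole))) := by
  obtain ⟨p, q⟩ := p
  rcases (isPole_iff _).1 h₁ with rfl | rfl <;> rcases (isPole_iff _).1 h₂ with rfl | rfl <;>
    simp [northPole_coord, southPole_coord]

theorem singularity_type {R₁ R₂ A B C : ℝ} (hR₁ : 0 < R₁) (hR₂ : 0 < R₂)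
    (hC : C = 0 → A * R₂ ≠ B * R₁) (hE : mixedDisc R₁ R₂ A B C ≠ 0) {p : S2 × S2}
    (hs : IsSingularPt I22 (sysL R₁ R₂) (sphereFun A B C) p) :
    IsEllipticElliptic (prodForm R₁ R₂) (sysL R₁ R₂) (sphereFun A B C) p ∨
      IsFocusFocus (prodForm R₁ R₂) (sysL R₁ R₂) (sphereFun A B C) p ∨
      IsEllipticRegular (prodForm R₁ R₂) (sysL R₁ R₂) (sphereFun A B C) p := by
  by_cases hp : IsPole p.1 ∧ IsPole p.2
  · obtain ⟨h₁, h₂⟩ := hp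
    rcases pole_cases h₁ h₂ with h | ⟨h, -⟩
    · exact Or.inl (isEllipticElliptic_of_poleDisc hR₁ hR₂ A B C h₁ h₂
        (poleDisc_pos_of_eq hR₁ hR₂ hC h))
    · have hd := poleDisc_mixed hR₁ hR₂ A B C h
      have hpos : 0 < (R₁ * R₂) ^ 2 := by positivity
      rcases lt_or_gt_of_ne hE with hneg | hgt
      · exact Or.inr (Or.inl (isFocusFocus_of_poleDisc hR₁ hR₂ A B C h₁ h₂
          (hd ▸ div_neg_of_neg_of_pos hneg hpos)))
      · exact Or.inl (isEllipticElliptic_of_poleDisc hR₁ hR₂ A B C h₁ h₂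
          (hd ▸ div_pos hgt hpos))
  · exact Or.inr (Or.inr (isEllipticRegular_of_singular hR₁ hR₂ hC hp hs))

theorem eq_of_isFocusFocus {R₁ R₂ A B C : ℝ} (hR₁ : 0 < R₁) (hR₂ : 0 < R₂)
    (hC : C = 0 → A * R₂ ≠ B * R₁) {p : S2 × S2}
    (h : IsFocusFocus (prodForm R₁ R₂) (sysL R₁ R₂) (sphereFun A B C) p) :
    mixedDisc R₁ R₂ A B C < 0 ∧ (p = (northPole, southPole) ∨ p = (southPole, northPole)) := by
  obtain ⟨h₁, h₂⟩ := not_isPole_of_rankAt hR₁ hR₂ h.1.1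
  rcases pole_cases h₁ h₂ with hz | ⟨hz, hp⟩
  · exact absurd h (not_isFocusFocus_of_poleDisc hR₁ hR₂ A B C h₁ h₂
      (poleDisc_pos_of_eq hR₁ hR₂ hC hz).le)
  · refine ⟨?_, hp⟩
    by_contra! hge
    refine not_isFocusFocus_of_poleDisc hR₁ hR₂ A B C h₁ h₂ ?_ h
    rw [poleDisc_mixed hR₁ hR₂ A B C hz]
    positivity

theorem northPole_ne_southPole : northPole ≠ southPole := by
  intro h
  have := congrArg (fun q : S2 => (q : R3) 2) h
  simp only [northPole_coord, southPole_coord] at this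
  norm_num at this

theorem isSimpleSemitoric_sphereFun {R₁ R₂ A B C : ℝ} (hR₁ : 0 < R₁) (hR₂ : 0 < R₂)
    (hR : R₁ ≠ R₂) (hC : C = 0 → A * R₂ ≠ B * R₁) (hE : mixedDisc R₁ R₂ A B C ≠ 0) :
    IsSimpleSemitoric (prodForm R₁ R₂) (sysL R₁ R₂) (sphereFun A B C) where
  integrable := isCompletelyIntegrable_sphereFun hR₁ hR₂ hC
  singularities _ hs := singularity_type hR₁ hR₂ hC hE hs
  circle_action := inducesEffectiveCircleAction_sysL hR₁ hR₂
  proper := isCompact_preimage_sysL R₁ R₂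
  simple p q hp hq h := by
    rcases (eq_of_isFocusFocus hR₁ hR₂ hC hp).2 with rfl | rfl <;>
      rcases (eq_of_isFocusFocus hR₁ hR₂ hC hq).2 with rfl | rfl
    · rfl
    -- The two values of `L` are `R₁ - R₂` and its opposite.
    · simp only [sysL, northPole_coord, southPole_coord] at h
      exact absurd (by linarith) hR
    · simp only [sysL, northPole_coord, southPole_coord] at h
      exact absurd (by linarith) hR
    · rfl

theorem isDegenerate_of_mixedDisc {R₁ R₂ A B C : ℝ} (hR₁ : 0 < R₁) (hR₂ : 0 < R₂) (hC : C ≠ 0)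
    (hE : mixedDisc R₁ R₂ A B C = 0) {p : S2 × S2} (h₁ : IsPole p.1) (h₂ : IsPole p.2)
    (hp : (p.1 : R3) 2 * (p.2 : R3) 2 = -1) :
    IsDegenerateSingularPt (prodForm R₁ R₂) (sysL R₁ R₂) (sphereFun A B C) p := by
  have hr := rankAt_of_isPole R₁ R₂ A B C h₁ h₂
  refine ⟨lt_of_eq_of_lt hr two_pos, ?_⟩
  rintro (h | h)
  · refine not_isNondegRankZero_of_poleDisc hR₁ hR₂ A B C h₁ h₂ ?_ hC h
    rw [poleDisc_mixed hR₁ hR₂ A B C hp, hE, zero_div]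
  · exact absurd (hr.symm.trans h.1) (by norm_num)

theorem IsSemitoric.not_isDegenerateSingularPt {R₁ R₂ : ℝ} {L K : S2 × S2 → ℝ}
    (h : IsSemitoric (prodForm R₁ R₂) L K) (p : S2 × S2) :
    ¬ IsDegenerateSingularPt (prodForm R₁ R₂) L K p := by
  rintro ⟨hs, hd⟩
  rcases h.singularities p hs with h | h | h
  · exact hd (Or.inl h.1)
  · exact hd (Or.inl h.1)
  · exact hd (Or.inr h.1)

theorem encard_isFocusFocus_of_neg {R₁ R₂ A B C : ℝ} (hR₁ : 0 < R₁) (hR₂ : 0 < R₂)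
    (hC : C = 0 → A * R₂ ≠ B * R₁) (hE : mixedDisc R₁ R₂ A B C < 0) :
    {p : S2 × S2 | IsFocusFocus (prodForm R₁ R₂) (sysL R₁ R₂) (sphereFun A B C) p}.encard = 2 := by
  have hff {p : S2 × S2} (h₁ : IsPole p.1) (h₂ : IsPole p.2)
      (hp : (p.1 : R3) 2 * (p.2 : R3) 2 = -1) :
      IsFocusFocus (prodForm R₁ R₂) (sysL R₁ R₂) (sphereFun A B C) p := by
    refine isFocusFocus_of_poleDisc hR₁ hR₂ A B C h₁ h₂ ?_
    rw [poleDisc_mixed hR₁ hR₂ A B C hp]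
    exact div_neg_of_neg_of_pos hE (by positivity)
  have h : {p : S2 × S2 | IsFocusFocus (prodForm R₁ R₂) (sysL R₁ R₂) (sphereFun A B C) p}
      = {(northPole, southPole), (southPole, northPole)} := by
    ext p
    constructor
    · intro hp
      exact (eq_of_isFocusFocus hR₁ hR₂ hC hp).2
    · rintro (rfl | rfl)
      · exact hff isPole_northPole isPole_southPole (by simp [northPole_coord, southPole_coord])
      · exact hff isPole_southPole isPole_northPole (by simp [northPole_coord, southPole_coord])
  rw [h]
  exact encard_pair fun h => northPole_ne_southPole (congrArg Prod.fst h)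

theorem encard_isFocusFocus_of_pos {R₁ R₂ A B C : ℝ} (hR₁ : 0 < R₁) (hR₂ : 0 < R₂)
    (hC : C = 0 → A * R₂ ≠ B * R₁) (hE : 0 < mixedDisc R₁ R₂ A B C) :
    {p : S2 × S2 | IsFocusFocus (prodForm R₁ R₂) (sysL R₁ R₂) (sphereFun A B C) p}.encard = 0 := by
  rw [encard_eq_zero, eq_empty_iff_forall_notMem]
  intro p hp
  exact (eq_of_isFocusFocus hR₁ hR₂ hC hp).1.not_gt hE

/-! ### The parameter square -/

theorem polyE_eq_mixedDisc (R₁ R₂ s₁ s₂ : ℝ) :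
    polyE R₁ R₂ s₁ s₂ = mixedDisc R₁ R₂ ((1 - 2 * s₁) * (1 - s₂)) ((1 - 2 * s₁) * s₂)
      (2 * (s₁ + s₂ - s₁ ^ 2 - s₂ ^ 2)) := by
  unfold polyE mixedDisc
  ring

/-- The coupling is `2 (s₁ (1 - s₁) + s₂ (1 - s₂))`, so it vanishes only at the corners, where
exactly one of the two height coefficients vanishes. -/
theorem coupling_ne_zero_or {R₁ R₂ : ℝ} (hR₁ : 0 < R₁) (hR₂ : 0 < R₂) {s₁ s₂ : ℝ}
    (h₁ : s₁ ∈ Icc (0 : ℝ) 1) (h₂ : s₂ ∈ Icc (0 : ℝ) 1)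
    (h : 2 * (s₁ + s₂ - s₁ ^ 2 - s₂ ^ 2) = 0) :
    (1 - 2 * s₁) * (1 - s₂) * R₂ ≠ (1 - 2 * s₁) * s₂ * R₁ := by
  have e₁ : 0 ≤ s₁ * (1 - s₁) := mul_nonneg h₁.1 (sub_nonneg.2 h₁.2)
  have e₂ : 0 ≤ s₂ * (1 - s₂) := mul_nonneg h₂.1 (sub_nonneg.2 h₂.2)
  have f₁ : s₁ * (1 - s₁) = 0 := by linarith
  have f₂ : s₂ * (1 - s₂) = 0 := by linarith
  intro hab
  rcases mul_eq_zero.1 f₁ with r₁ | r₁ <;> rcases mul_eq_zero.1 f₂ with r₂ | r₂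
  · rw [r₁, r₂] at hab; linarith
  · rw [r₁, (sub_eq_zero.1 r₂).symm] at hab; linarith
  · rw [(sub_eq_zero.1 r₁).symm, r₂] at hab; linarith
  · rw [(sub_eq_zero.1 r₁).symm, (sub_eq_zero.1 r₂).symm] at hab; linarith

theorem coupling_ne_zero_of_polyE {R₁ R₂ : ℝ} (hR₁ : 0 < R₁) (hR₂ : 0 < R₂) {s₁ s₂ : ℝ}
    (h₁ : s₁ ∈ Icc (0 : ℝ) 1) (h₂ : s₂ ∈ Icc (0 : ℝ) 1) (hE : polyE R₁ R₂ s₁ s₂ = 0) :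
    2 * (s₁ + s₂ - s₁ ^ 2 - s₂ ^ 2) ≠ 0 := by
  intro h
  rw [polyE_eq_mixedDisc, mixedDisc, h] at hE
  have h0 : R₂ * ((1 - 2 * s₁) * (1 - s₂)) - R₁ * ((1 - 2 * s₁) * s₂) = 0 :=
    pow_eq_zero_iff two_ne_zero |>.1 (by linarith)
  exact coupling_ne_zero_or hR₁ hR₂ h₁ h₂ h (by linarith)

theorem isSimpleSemitoric_of_polyE_ne_zero {R₁ R₂ : ℝ} (hR₁ : 0 < R₁) (hR₂ : 0 < R₂)
    (hR : R₁ ≠ R₂) {s₁ s₂ : ℝ} (h₁ : s₁ ∈ Icc (0 : ℝ) 1) (h₂ : s₂ ∈ Icc (0 : ℝ) 1)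
    (hE : polyE R₁ R₂ s₁ s₂ ≠ 0) :
    IsSimpleSemitoric (prodForm R₁ R₂) (sysL R₁ R₂) (sysH s₁ s₂) := by
  rw [sysH_eq]
  rw [polyE_eq_mixedDisc] at hE
  exact isSimpleSemitoric_sphereFun hR₁ hR₂ hR (coupling_ne_zero_or hR₁ hR₂ h₁ h₂) hE

theorem isDegenerate_of_polyE_eq_zero {R₁ R₂ : ℝ} (hR₁ : 0 < R₁) (hR₂ : 0 < R₂) {s₁ s₂ : ℝ}
    (h₁ : s₁ ∈ Icc (0 : ℝ) 1) (h₂ : s₂ ∈ Icc (0 : ℝ) 1) (hE : polyE R₁ R₂ s₁ s₂ = 0) :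
    IsDegenerateSingularPt (prodForm R₁ R₂) (sysL R₁ R₂) (sysH s₁ s₂) (northPole, southPole) ∧
      IsDegenerateSingularPt (prodForm R₁ R₂) (sysL R₁ R₂) (sysH s₁ s₂)
        (southPole, northPole) := by
  have hC := coupling_ne_zero_of_polyE hR₁ hR₂ h₁ h₂ hE
  rw [polyE_eq_mixedDisc] at hE
  rw [sysH_eq]
  exact ⟨isDegenerate_of_mixedDisc hR₁ hR₂ hC hE isPole_northPole isPole_southPole
      (by simp only [northPole_coord, southPole_coord]; norm_num),
    isDegenerate_of_mixedDisc hR₁ hR₂ hC hE isPole_southPole isPole_northPole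
      (by simp only [northPole_coord, southPole_coord]; norm_num)⟩

/-! ### The zero set of `polyE` is a null set -/

theorem continuous_polyE (R₁ R₂ : ℝ) : Continuous fun s : ℝ × ℝ => polyE R₁ R₂ s.1 s.2 := by
  unfold polyE
  fun_prop

theorem finite_setOf_polyE_eq_zero {R₁ R₂ : ℝ} (hR₁ : 0 < R₁) (hR₂ : 0 < R₂) (s₁ : ℝ) :
    {s₂ : ℝ | polyE R₁ R₂ s₁ s₂ = 0}.Finite := by
  let P : ℝ[X] := C (R₂ ^ 2 * (1 - 2 * s₁) ^ 2) * (X - 1) ^ 2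
    + C (R₁ ^ 2 * (1 - 2 * s₁) ^ 2) * X ^ 2
    - C (2 * R₁ * R₂) * (C (8 * (-1 + s₁) ^ 2 * s₁ ^ 2) + C (1 - 12 * (-1 + s₁) * s₁) * X
      + C (7 + 12 * (-1 + s₁) * s₁) * X ^ 2 - C 16 * X ^ 3 + C 8 * X ^ 4)
  have hP : P ≠ 0 := by
    -- The leading coefficient in `s₂` does not depend on `s₁`, so no slice is degenerate.
    have h4 : P.coeff 4 = -(2 * R₁ * R₂ * 8) := by
      have : P = C (R₂ ^ 2 * (1 - 2 * s₁) ^ 2) * (X ^ 2 - C 2 * X + C 1)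
          + C (R₁ ^ 2 * (1 - 2 * s₁) ^ 2) * X ^ 2
          - C (2 * R₁ * R₂) * (C (8 * (-1 + s₁) ^ 2 * s₁ ^ 2) + C (1 - 12 * (-1 + s₁) * s₁) * X
            + C (7 + 12 * (-1 + s₁) * s₁) * X ^ 2 - C 16 * X ^ 3 + C 8 * X ^ 4) := by
        have h2 : (C 2 : ℝ[X]) = 2 := rfl
        simp only [P, h2, map_one]
        ring
      rw [this]
      simp only [coeff_add, coeff_sub, coeff_C_mul, coeff_X_pow, coeff_C, coeff_X]
      norm_num
    intro h
    rw [h, coeff_zero] at h4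
    have := mul_pos hR₁ hR₂
    linarith
  refine (Polynomial.finite_setOfPred_isRoot hP).subset fun s₂ h => ?_
  rw [mem_ofPred_eq, IsRoot.def, ← (h : polyE R₁ R₂ s₁ s₂ = 0)]
  simp only [P, polyE, eval_add, eval_sub, eval_mul, eval_pow, eval_C, eval_X, eval_one]
  ring

theorem volume_setOf_polyE_eq_zero {R₁ R₂ : ℝ} (hR₁ : 0 < R₁) (hR₂ : 0 < R₂) :
    volume {s : ℝ × ℝ | polyE R₁ R₂ s.1 s.2 = 0} = 0 := by
  have hm : MeasurableSet {s : ℝ × ℝ | polyE R₁ R₂ s.1 s.2 = 0} :=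
    (isClosed_eq (continuous_polyE R₁ R₂) continuous_const).measurableSet
  rw [Measure.volume_eq_prod, Measure.measure_prod_null hm]
  exact Filter.Eventually.of_forall fun s₁ => (finite_setOf_polyE_eq_zero hR₁ hR₂ s₁).measure_zero _

/-! ### Piecewise smooth curves -/

theorem IsPiecewiseSmoothCurve.union {Z W : Set (ℝ × ℝ)} (hZ : IsPiecewiseSmoothCurve Z)
    (hW : IsPiecewiseSmoothCurve W) : IsPiecewiseSmoothCurve (Z ∪ W) := by
  obtain ⟨m, γ, hm, hγ, rfl⟩ := hZ
  obtain ⟨n, δ, hn, hδ, rfl⟩ := hW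
  refine ⟨m + n, Fin.append γ δ, by omega, fun i => ?_, ?_⟩
  · induction i using Fin.addCases with
    | left i => simpa only [Fin.append_left] using hγ i
    | right i => simpa only [Fin.append_right] using hδ i
  · ext s
    simp only [mem_union, mem_iUnion]
    constructor
    · rintro (⟨i, h⟩ | ⟨i, h⟩)
      · exact ⟨Fin.castAdd n i, by simpa only [Fin.append_left] using h⟩
      · exact ⟨Fin.natAdd m i, by simpa only [Fin.append_right] using h⟩
    · rintro ⟨i, h⟩
      induction i using Fin.addCases with
      | left i => exact Or.inl ⟨i, by simpa only [Fin.append_left] using h⟩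
      | right i => exact Or.inr ⟨i, by simpa only [Fin.append_right] using h⟩

theorem isPiecewiseSmoothCurve_graph {a b : ℝ} (hab : a < b) {φ : ℝ → ℝ}
    (hφ : ContDiffOn ℝ ∞ φ (Icc a b)) :
    IsPiecewiseSmoothCurve {s : ℝ × ℝ | s.2 ∈ Icc a b ∧ s.1 = φ s.2} := by
  have hmaps : MapsTo (fun t : ℝ => a + (b - a) * t) (Icc 0 1) (Icc a b) := fun t ht =>
    ⟨by nlinarith [ht.1], by nlinarith [ht.2]⟩
  have hsm : ContDiffOn ℝ ∞ (fun t : ℝ => (φ (a + (b - a) * t), a + (b - a) * t)) (Icc 0 1) := by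
    have hl : ContDiff ℝ ∞ fun t : ℝ => a + (b - a) * t := by fun_prop
    exact (hφ.comp hl.contDiffOn hmaps).prodMk hl.contDiffOn
  refine ⟨1, fun _ t => (φ (a + (b - a) * t), a + (b - a) * t), one_pos,
    fun _ => ⟨hsm, fun t _ u _ h => ?_, fun t ht h0 => ?_⟩, ?_⟩
  -- Injectivity and regularity are both visible on the second coordinate, which is affine in `t`
  -- with slope `b - a`.
  · have := (Prod.mk.inj h).2
    exact mul_left_cancel₀ (sub_pos.2 hab).ne' (add_left_cancel this)
  · have hd := ((hsm.differentiableOn (by simp)) t ht).hasDerivWithinAt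
    rw [h0] at hd
    have h₂ := hd.snd
    have h₂' : HasDerivWithinAt (fun t : ℝ => a + (b - a) * t) (b - a) (Icc 0 1) t := by
      simpa using (((hasDerivAt_id t).const_mul (b - a)).const_add a).hasDerivWithinAt
    have := (uniqueDiffOn_Icc_zero_one t ht).eq_deriv _ h₂ h₂'
    simp only [Prod.snd_zero] at this
    linarith
  · ext ⟨x, y⟩
    simp only [mem_ofPred_eq, iUnion_const, mem_image, Prod.mk.injEq]
    constructor
    · rintro ⟨hy, rfl⟩
      have hy' : a + (b - a) * ((y - a) / (b - a)) = y := by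
        field_simp [(sub_pos.2 hab).ne']
        ring
      refine ⟨(y - a) / (b - a), ⟨div_nonneg (sub_nonneg.2 hy.1) (sub_pos.2 hab).le, ?_⟩, ?_, hy'⟩
      · rw [div_le_one (sub_pos.2 hab)]
        linarith [hy.2]
      · rw [hy']
    · rintro ⟨t, ht, rfl, rfl⟩
      exact ⟨hmaps ht, rfl⟩

/-! ### The zero set of `polyE` as a union of arcs -/

theorem exists_quadratic_nonneg_iff_of_neg_pos {k σ ρ : ℝ} (hk : 0 < k) (h₀ : k - σ + ρ < 0)
    (h₁ : 0 < k + σ + ρ) :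
    ∃ c : ℝ, -1 < c ∧ c < 1 ∧ ∀ y ∈ Icc (-1 : ℝ) 1, 0 ≤ k * y ^ 2 + σ * y + ρ ↔ c ≤ y := by
  have hc : ContinuousOn (fun y : ℝ => k * y ^ 2 + σ * y + ρ) (Icc (-1) 1) := by fun_prop
  obtain ⟨c, hcI, hcz⟩ := intermediate_value_Icc (by norm_num : (-1 : ℝ) ≤ 1) hc
    (show (0 : ℝ) ∈ _ from ⟨by linarith, by linarith⟩)
  simp only at hcz
  have hc0 : c ≠ -1 := by rintro rfl; linarith
  have hc1 : c ≠ 1 := by rintro rfl; linarith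
  have hc0' : -1 < c := lt_of_le_of_ne hcI.1 hc0.symm
  have hc1' : c < 1 := lt_of_le_of_ne hcI.2 hc1
  -- The cofactor of `y - c` is `k (y + c) + σ`; at `y = -1` its sign follows from that of the
  -- quadratic, and it increases with `y`.
  have hs : 0 < k * (-1 + c) + σ := by
    have : (1 + c) * (k * (-1 + c) + σ) = -(k - σ + ρ) := by linear_combination hcz
    exact pos_of_mul_pos_right (by rw [this]; linarith) (by linarith)
  refine ⟨c, hc0', hc1', fun y hy => ?_⟩
  have hf : k * y ^ 2 + σ * y + ρ = (k * (y + c) + σ) * (y - c) := by linear_combination hcz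
  have hp : 0 < k * (y + c) + σ := by nlinarith [hy.1]
  rw [hf, mul_nonneg_iff_of_pos_left hp, sub_nonneg]

/-- Opposite signs at `±1` leave a single sign change in `[-1, 1]`; the two cases are exchanged by
`y ↦ -y`. -/
theorem exists_quadratic_nonneg_iff {k σ ρ : ℝ} (hk : 0 < k)
    (h : (k - σ + ρ) * (k + σ + ρ) < 0) :
    ∃ a b : ℝ, a < b ∧ ∀ y, (y ∈ Icc (-1 : ℝ) 1 ∧ 0 ≤ k * y ^ 2 + σ * y + ρ) ↔ y ∈ Icc a b := by
  rcases mul_neg_iff.1 h with ⟨h₀, h₁⟩ | ⟨h₀, h₁⟩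
  · obtain ⟨c, hc₀, hc₁, hc⟩ := exists_quadratic_nonneg_iff_of_neg_pos (σ := -σ) (ρ := ρ) hk
      (by linarith) (by linarith)
    refine ⟨-1, -c, by linarith, fun y => ⟨fun ⟨hy, hq⟩ => ⟨hy.1, ?_⟩, fun hy => ?_⟩⟩
    · have := (hc (-y) ⟨by linarith [hy.2], by linarith [hy.1]⟩).1 (by linarith)
      linarith
    · have hy' : y ≤ 1 := by linarith [hy.2]
      have := (hc (-y) ⟨by linarith, by linarith [hy.1]⟩).2 (by linarith [hy.2])
      exact ⟨⟨hy.1, hy'⟩, by linarith⟩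
  · obtain ⟨c, hc₀, hc₁, hc⟩ := exists_quadratic_nonneg_iff_of_neg_pos hk h₀ h₁
    refine ⟨c, 1, hc₁, fun y => ⟨fun ⟨hy, hq⟩ => ⟨(hc y hy).1 hq, hy.2⟩, fun hy => ?_⟩⟩
    have hy' : y ∈ Icc (-1 : ℝ) 1 := ⟨by linarith [hy.1], hy.2⟩
    exact ⟨hy', (hc y hy').2 hy.1⟩

/-- The positive root `x` of `2 k x² + (δ + σ y) x = 2 k (2 - y²)`. -/
def posRoot (k σ δ y : ℝ) : ℝ :=
  (√((δ + σ * y) ^ 2 + 16 * k ^ 2 * (2 - y ^ 2)) - (δ + σ * y)) / (4 * k)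

theorem posRoot_disc_pos {k : ℝ} (hk : 0 < k) (σ δ : ℝ) {y : ℝ} (hy : y ∈ Icc (-1 : ℝ) 1) :
    0 < (δ + σ * y) ^ 2 + 16 * k ^ 2 * (2 - y ^ 2) := by
  have : y ^ 2 ≤ 1 := by nlinarith [hy.1, hy.2]
  have : 0 < 16 * k ^ 2 * (2 - y ^ 2) := by
    apply mul_pos (by positivity)
    linarith
  positivity

theorem contDiffOn_posRoot {k : ℝ} (hk : 0 < k) (σ δ : ℝ) :
    ContDiffOn ℝ ∞ (posRoot k σ δ) (Icc (-1) 1) := by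
  unfold posRoot
  refine ContDiffOn.div_const (ContDiffOn.sub (ContDiffOn.sqrt (by fun_prop) fun y hy =>
    (posRoot_disc_pos hk σ δ hy).ne') (by fun_prop)) _

theorem abs_lt_sqrt_posRoot_disc {k : ℝ} (hk : 0 < k) (σ δ : ℝ) {y : ℝ}
    (hy : y ∈ Icc (-1 : ℝ) 1) :
    |δ + σ * y| < √((δ + σ * y) ^ 2 + 16 * k ^ 2 * (2 - y ^ 2)) := by
  have : y ^ 2 ≤ 1 := by nlinarith [hy.1, hy.2]
  have : 0 < 16 * k ^ 2 * (2 - y ^ 2) := by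
    apply mul_pos (by positivity)
    linarith
  refine Real.lt_sqrt_of_sq_lt ?_
  rw [sq_abs]
  linarith

theorem posRoot_pos {k : ℝ} (hk : 0 < k) (σ δ : ℝ) {y : ℝ} (hy : y ∈ Icc (-1 : ℝ) 1) :
    0 < posRoot k σ δ y :=
  div_pos (sub_pos.2 (lt_of_abs_lt (abs_lt_sqrt_posRoot_disc hk σ δ hy))) (by positivity)

/-- The product of the roots is `-(2 - y²) < 0`. The negative root is minus the positive root of the
quadratic with `σ`, `δ` negated, since `x ↦ -x` exchanges the two. -/
theorem quadratic_eq_posRoot {k : ℝ} (hk : 0 < k) (σ δ x : ℝ) {y : ℝ}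
    (hy : y ∈ Icc (-1 : ℝ) 1) :
    2 * k * x ^ 2 + (δ + σ * y) * x - 2 * k * (2 - y ^ 2) =
      2 * k * (x - posRoot k σ δ y) * (x + posRoot k (-σ) (-δ) y) := by
  have hs := Real.sq_sqrt (posRoot_disc_pos hk σ δ hy).le
  have e : (-δ + -σ * y) ^ 2 + 16 * k ^ 2 * (2 - y ^ 2)
      = (δ + σ * y) ^ 2 + 16 * k ^ 2 * (2 - y ^ 2) := by ring
  unfold posRoot
  rw [e]
  set r := √((δ + σ * y) ^ 2 + 16 * k ^ 2 * (2 - y ^ 2))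
  field_simp
  linear_combination 2 * hs

theorem posRoot_le_one_iff {k : ℝ} (hk : 0 < k) (σ δ : ℝ) {y : ℝ} (hy : y ∈ Icc (-1 : ℝ) 1) :
    posRoot k σ δ y ≤ 1 ↔ 0 ≤ 2 * k * y ^ 2 + σ * y + (δ - 2 * k) := by
  have h := quadratic_eq_posRoot hk σ δ 1 hy
  have h' : 2 * k * y ^ 2 + σ * y + (δ - 2 * k) =
      2 * k * (1 + posRoot k (-σ) (-δ) y) * (1 - posRoot k σ δ y) := by linear_combination h
  have := posRoot_pos hk (-σ) (-δ) hy
  rw [h', mul_nonneg_iff_of_pos_left (by positivity), sub_nonneg]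

theorem isPiecewiseSmoothCurve_posRoot {k σ δ : ℝ} (hk : 0 < k) (hσ : δ ^ 2 < σ ^ 2)
    {ε : ℝ} (hε : ε ^ 2 = 1) :
    IsPiecewiseSmoothCurve {s : ℝ × ℝ | s.1 ∈ Icc (0 : ℝ) 1 ∧ s.2 ∈ Icc (0 : ℝ) 1 ∧
      1 - 2 * s.1 = ε * posRoot k σ δ (1 - 2 * s.2)} := by
  -- The condition `posRoot ≤ 1` is a quadratic inequality in `y` with end values `δ ∓ σ`, of
  -- product `δ² - σ² < 0`; hence the arc lies over one interval of positive length.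
  obtain ⟨a, b, hab, h⟩ := exists_quadratic_nonneg_iff (k := 2 * k) (σ := σ) (ρ := δ - 2 * k)
    (by positivity) (by linarith)
  have hI : ∀ y ∈ Icc a b, y ∈ Icc (-1 : ℝ) 1 := fun y hy => ((h y).2 hy).1
  have key := isPiecewiseSmoothCurve_graph (a := (1 - b) / 2) (b := (1 - a) / 2) (by linarith)
    (φ := fun t => (1 - ε * posRoot k σ δ (1 - 2 * t)) / 2) (by
      refine ContDiffOn.div_const (contDiffOn_const.sub (contDiffOn_const.mul
        ((contDiffOn_posRoot hk σ δ).comp (by fun_prop) fun t ht => hI _ ?_))) _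
      exact ⟨by linarith [ht.2], by linarith [ht.1]⟩)
  convert key using 1
  ext ⟨s₁, s₂⟩
  simp only [mem_ofPred_eq]
  have hmem : s₂ ∈ Icc ((1 - b) / 2) ((1 - a) / 2) ↔ 1 - 2 * s₂ ∈ Icc a b :=
    ⟨fun hs => ⟨by linarith [hs.2], by linarith [hs.1]⟩,
      fun hs => ⟨by linarith [hs.2], by linarith [hs.1]⟩⟩
  have hsq : s₂ ∈ Icc (0 : ℝ) 1 ↔ 1 - 2 * s₂ ∈ Icc (-1 : ℝ) 1 :=
    ⟨fun hs => ⟨by linarith [hs.2], by linarith [hs.1]⟩,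
      fun hs => ⟨by linarith [hs.2], by linarith [hs.1]⟩⟩
  rw [hmem, ← h, hsq]
  constructor
  · rintro ⟨hs₁, hs₂, he⟩
    refine ⟨⟨hs₂, (posRoot_le_one_iff hk σ δ hs₂).1 ?_⟩, by linarith⟩
    have hp := posRoot_pos hk σ δ hs₂
    rcases (sq_eq_one_iff.1 hε) with rfl | rfl
    · linarith [hs₁.1]
    · linarith [hs₁.2]
  · rintro ⟨⟨hs₂, hq⟩, he⟩
    have hle := (posRoot_le_one_iff hk σ δ hs₂).2 hq
    have hp := posRoot_pos hk σ δ hs₂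
    refine ⟨?_, hs₂, by linarith⟩
    rcases (sq_eq_one_iff.1 hε) with rfl | rfl
    · exact ⟨by linarith, by linarith⟩
    · exact ⟨by linarith, by linarith⟩

/-- With `k = √(R₁ R₂)`, `R₂ A - R₁ B` is `x ((R₂ - R₁) + (R₁ + R₂) y) / 2` and the coupling is `(2
- x² - y²) / 2`. So `4 E` is minus the product of the quadratic of `posRoot` at `x` and at `-x`. -/
theorem polyE_eq_zero_iff {R₁ R₂ : ℝ} (hR₁ : 0 < R₁) (hR₂ : 0 < R₂) {s₁ s₂ : ℝ}
    (h₂ : s₂ ∈ Icc (0 : ℝ) 1) :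
    polyE R₁ R₂ s₁ s₂ = 0 ↔
      (1 - 2 * s₁ = 1 * posRoot √(R₁ * R₂) (R₁ + R₂) (R₂ - R₁) (1 - 2 * s₂) ∨
        1 - 2 * s₁ = -1 * posRoot √(R₁ * R₂) (R₁ + R₂) (R₂ - R₁) (1 - 2 * s₂)) ∨
      (1 - 2 * s₁ = 1 * posRoot √(R₁ * R₂) (-(R₁ + R₂)) (-(R₂ - R₁)) (1 - 2 * s₂) ∨
        1 - 2 * s₁ = -1 * posRoot √(R₁ * R₂) (-(R₁ + R₂)) (-(R₂ - R₁)) (1 - 2 * s₂)) := by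
  have hRR := mul_pos hR₁ hR₂
  have hk : 0 < √(R₁ * R₂) := Real.sqrt_pos.2 hRR
  have hk2 : √(R₁ * R₂) ^ 2 = R₁ * R₂ := Real.sq_sqrt hRR.le
  have hy : 1 - 2 * s₂ ∈ Icc (-1 : ℝ) 1 := ⟨by linarith [h₂.2], by linarith [h₂.1]⟩
  have hp := quadratic_eq_posRoot hk (R₁ + R₂) (R₂ - R₁) (1 - 2 * s₁) hy
  have hm := quadratic_eq_posRoot hk (R₁ + R₂) (R₂ - R₁) (-(1 - 2 * s₁)) hy
  set k := √(R₁ * R₂)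
  set u := posRoot k (R₁ + R₂) (R₂ - R₁) (1 - 2 * s₂)
  set w := posRoot k (-(R₁ + R₂)) (-(R₂ - R₁)) (1 - 2 * s₂)
  set x := 1 - 2 * s₁ with hx
  have hE : polyE R₁ R₂ s₁ s₂ = -k ^ 2 * ((x - u) * (x + w)) * ((-x - u) * (-x + w)) := by
    have : 4 * polyE R₁ R₂ s₁ s₂ = -(2 * k * (x - u) * (x + w)) * (2 * k * (-x - u) * (-x + w)) := by
      rw [← hp, ← hm, polyE_eq_mixedDisc, mixedDisc, ← hk2, hx]
      ring
    linear_combination this / 4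
  rw [hE]
  constructor
  · intro h
    have h' : ((x - u) * (x + w)) * ((-x - u) * (-x + w)) = 0 := by
      rw [mul_assoc] at h
      exact (mul_eq_zero.1 h).resolve_left (neg_ne_zero.2 (pow_pos hk 2).ne')
    rcases mul_eq_zero.1 h' with h' | h' <;> rcases mul_eq_zero.1 h' with h' | h'
    · exact Or.inl (Or.inl (by linarith))
    · exact Or.inr (Or.inr (by linarith))
    · exact Or.inl (Or.inr (by linarith))
    · exact Or.inr (Or.inl (by linarith))
  · rintro ((h | h) | (h | h)) <;> rw [h] <;> ring

theorem isPiecewiseSmoothCurve_polyE {R₁ R₂ : ℝ} (hR₁ : 0 < R₁) (hR₂ : 0 < R₂) :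
    IsPiecewiseSmoothCurve
      {s : ℝ × ℝ | s.1 ∈ Icc (0 : ℝ) 1 ∧ s.2 ∈ Icc (0 : ℝ) 1 ∧ polyE R₁ R₂ s.1 s.2 = 0} := by
  have hRR := mul_pos hR₁ hR₂
  have hk : 0 < √(R₁ * R₂) := Real.sqrt_pos.2 hRR
  have hσ : (R₂ - R₁) ^ 2 < (R₁ + R₂) ^ 2 := by linarith
  have hσ' : (-(R₂ - R₁)) ^ 2 < (-(R₁ + R₂)) ^ 2 := by linarith
  have e₁ : (1 : ℝ) ^ 2 = 1 := by norm_num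
  have e₂ : (-1 : ℝ) ^ 2 = 1 := by norm_num
  convert ((isPiecewiseSmoothCurve_posRoot hk hσ e₁).union
    (isPiecewiseSmoothCurve_posRoot hk hσ e₂)).union
    ((isPiecewiseSmoothCurve_posRoot hk hσ' e₁).union
    (isPiecewiseSmoothCurve_posRoot hk hσ' e₂)) using 1
  ext ⟨s₁, s₂⟩
  simp only [mem_union, mem_ofPred_eq, ← and_or_left]
  exact and_congr_right fun _ => and_congr_right fun h₂ => polyE_eq_zero_iff hR₁ hR₂ h₂

end

/-! ### The main theorem. -/

theorem mainTheorem2 (R₁ R₂ : ℝ) (hR₁ : 0 < R₁) (hR₂ : 0 < R₂) (hR : R₁ ≠ R₂) :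
    (∀ s₁ ∈ Icc (0 : ℝ) 1, ∀ s₂ ∈ Icc (0 : ℝ) 1,
      (polyE R₁ R₂ s₁ s₂ ≠ 0 →
        IsSimpleSemitoric (prodForm R₁ R₂) (sysL R₁ R₂) (sysH s₁ s₂)) ∧
      (polyE R₁ R₂ s₁ s₂ = 0 →
        ¬ IsSemitoric (prodForm R₁ R₂) (sysL R₁ R₂) (sysH s₁ s₂) ∧
        IsDegenerateSingularPt (prodForm R₁ R₂) (sysL R₁ R₂) (sysH s₁ s₂)
          (northPole, southPole) ∧
        IsDegenerateSingularPt (prodForm R₁ R₂) (sysL R₁ R₂) (sysH s₁ s₂)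
          (southPole, northPole)) ∧
      (polyE R₁ R₂ s₁ s₂ < 0 →
        {p : S2 × S2 | IsFocusFocus (prodForm R₁ R₂) (sysL R₁ R₂) (sysH s₁ s₂) p}.encard = 2) ∧
      (0 < polyE R₁ R₂ s₁ s₂ →
        {p : S2 × S2 | IsFocusFocus (prodForm R₁ R₂) (sysL R₁ R₂) (sysH s₁ s₂) p}.encard = 0)) ∧
    IsPiecewiseSmoothCurve
      {s : ℝ × ℝ | s.1 ∈ Icc (0 : ℝ) 1 ∧ s.2 ∈ Icc (0 : ℝ) 1 ∧ polyE R₁ R₂ s.1 s.2 = 0} ∧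
    (∀ᵐ s : ℝ × ℝ, s.1 ∈ Icc (0 : ℝ) 1 → s.2 ∈ Icc (0 : ℝ) 1 →
      IsSimpleSemitoric (prodForm R₁ R₂) (sysL R₁ R₂) (sysH s.1 s.2)) := by
  refine ⟨fun s₁ h₁ s₂ h₂ => ⟨isSimpleSemitoric_of_polyE_ne_zero hR₁ hR₂ hR h₁ h₂, fun hE => ?_,
    fun hE => ?_, fun hE => ?_⟩, isPiecewiseSmoothCurve_polyE hR₁ hR₂, ?_⟩
  · have hd := isDegenerate_of_polyE_eq_zero hR₁ hR₂ h₁ h₂ hE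
    -- All three types allowed in a semitoric system are non-degenerate, so one degenerate point
    -- suffices.
    exact ⟨fun h => h.not_isDegenerateSingularPt _ hd.1, hd⟩
  · rw [polyE_eq_mixedDisc] at hE
    rw [sysH_eq]
    exact encard_isFocusFocus_of_neg hR₁ hR₂ (coupling_ne_zero_or hR₁ hR₂ h₁ h₂) hE
  · rw [polyE_eq_mixedDisc] at hE
    rw [sysH_eq]
    exact encard_isFocusFocus_of_pos hR₁ hR₂ (coupling_ne_zero_or hR₁ hR₂ h₁ h₂) hE
  · have h0 : ∀ᵐ s : ℝ × ℝ, polyE R₁ R₂ s.1 s.2 ≠ 0 := by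
      rw [ae_iff]
      simpa only [ne_eq, not_not] using volume_setOf_polyE_eq_zero hR₁ hR₂
    filter_upwards [h0] with s hs h₁ h₂
    exact isSimpleSemitoric_of_polyE_ne_zero hR₁ hR₂ hR h₁ h₂ hs
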